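/- **Setting.** Let $X$ be a set and let $\hat\Sigma$ be a simplicial complex over $X$, i.e. a set of finite subsets of $X$ (simplices) that contains $\varnothing$ and is closed under taking subsets. Write $\tau\prec\sigma$ (or $\sigma\succ\tau$) if $\tau\subseteq\sigma$ and $|\sigma\setminus\tau|=1$. Let $m:\hat\Sigma\to(0,\infty)$ be a weight. Put $\Sigma=\hat\Sigma$ if $\sum_{\{v\}\in\hat\Sigma}m(\{v\})<\infty$ and $\Sigma=\hat\Sigma\setminus\{\varnothing\}$ otherwise, and assume that $m$ is locally summable: $\sum_{\sigma\succ\tau}m(\sigma)<\infty$ for all $\tau\in\Sigma$. Let $C(\Sigma)$ be the space of complex-valued functions on $\Sigma$ and $\ell^2=\{\omega\in C(\Sigma):\sum_{\tau\in\Sigma}m(\tau)|\omega(\tau)|^2<\infty\}$. Let $\delta:C(\Sigma)\to C(\Sigma)$ be a coboundary operator, i.e. a linear operator such that $\theta(\tau,\sigma):=\delta 1_\tau(\sigma)\in\{1,-1,0\}$, with $\theta(\tau,\sigma)\neq0$ if and only if $\tau\prec\sigma$, $\ \delta\omega(\sigma)=\sum_{\tau\prec\sigma}\theta(\tau,\sigma)\omega(\tau)$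 for all $\omega\in C(\Sigma)$ and $\sigma\in\Sigma$, and $\delta\delta=0$. The boundary operator $\partial$ has domain $$D(\partial)=\Big\{\omega\in C(\Sigma):\ \sum_{\tau\succ\rho}m(\tau)|\omega(\tau)|<\infty\ \text{ for all }\rho\in\Sigma\Big\}$$ and acts by $$\partial\omega(\rho)=\frac1{m(\rho)}\sum_{\tau\succ\rho}m(\tau)\,\theta(\rho,\tau)\,\omega(\tau),\qquad \rho\in\Sigma;$$ let $D(\partial\partial)=\{\omega\in D(\partial):\partial\omega\in D(\partial)\}$. For $\rho\in\Sigma$, the link $\mathrm{lk}(\rho)$ is the set of vertices $v$ of $\hat\Sigma$ with $v\notin\rho$ and $\{v\}\cup\rho\in\hat\Sigma$, and the link graph $b_\rho:\mathrm{lk}(\rho)\times\mathrm{lk}(\rho)\to[0,\infty)$ is the weighted graph with $b_\rho(v,v')=m(\{v,v'\}\cup\rho)$ if $v\neq v'$ and $\{v,v'\}\cup\rho\in\hat\Sigma$, and $b_\rho(v,v')=0$ otherwise. Two vertices are joined by an edge if $b_\rho(v,v')>0$; connected components are meant with respect to these edges. By local summability $\sum_{v'}b_\rho(v,v')<\infty$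 for all $v$. A connected weighted graph $b$ over a vertex set $V$ is recurrent if the Markov chain $(Y_n)_{n\ge0}$ on $V$ with transition probabilities $\mathbb P(Y_n=y\mid Y_{n-1}=x)=b(x,y)/\sum_z b(x,z)$ (the chain stays put at a vertex without edges, so that a graph consisting of a single vertex is recurrent) satisfies $\mathbb P(Y_k=y\text{ for some }k>0\mid Y_0=x)=1$ for all $x,y\in V$. **Theorem.** Let $\rho\in\Sigma$. Then the following are equivalent: (i) $\partial\partial\omega(\rho)=0$ for all $\omega\in D(\partial\partial)\cap\ell^2$. (ii) All connected components of the graph $b_\rho$ over $\mathrm{lk}(\rho)$ are recurrent. -/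

import Mathlib

open MeasureTheory ProbabilityTheory

/-! ## Weighted graphs and recurrence -/

/-- A weighted graph over a discrete set `V`: a symmetric function `b : V × V → [0, ∞)` with
vanishing diagonal which is locally summable. -/
structure WeightedGraph (V : Type*) where
  b : V → V → ℝ
  nonneg : ∀ x y, 0 ≤ b x y
  symm : ∀ x y, b x y = b y x
  diag : ∀ x, b x x = 0
  summable : ∀ x, Summable (b x)

namespace WeightedGraph

variable {V : Type*} (G : WeightedGraph V)

/-- The underlying combinatorial graph: `x` and `y` are joined by an edge iff `b x y > 0`. -/
def toSimpleGraph : SimpleGraph V where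
  Adj x y := 0 < G.b x y
  symm := ⟨fun x y h => by rw [G.symm y x]; exact h⟩
  loopless := ⟨fun x h => by rw [G.diag x] at h; exact lt_irrefl _ h⟩

/-- The restriction of a weighted graph to a subset of its vertices. -/
def induce (s : Set V) : WeightedGraph s where
  b x y := G.b x y
  nonneg x y := G.nonneg x y
  symm x y := G.symm x y
  diag x := G.diag x
  summable x := (G.summable x).comp_injective Subtype.val_injective

/-- The total weight `∑_z b(x, z)` of the edges at `x`. -/
noncomputable def deg (x : V) : ℝ := ∑' z, G.b x z

open Classical in
/-- One step of the random walk from `x`: `P(Y_n = y | Y_{n-1} = x) = b(x, y) / ∑_z b(x, z)`.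
At a vertex without edges (where this fraction is `0 / 0`) the walk stays put. -/
noncomputable def step (x : V) : PMF V :=
  if h : G.deg x = 0 then PMF.pure x
  else ⟨fun y => ENNReal.ofReal (G.b x y / G.deg x), by
    have hpos : ∀ y, 0 ≤ G.b x y / G.deg x := fun y =>
      div_nonneg (G.nonneg x y) (tsum_nonneg (G.nonneg x))
    have hs : Summable fun y => G.b x y / G.deg x := (G.summable x).div_const _
    have h1 : ∑' y, ENNReal.ofReal (G.b x y / G.deg x) = 1 := by
      rw [← ENNReal.ofReal_tsum_of_nonneg hpos hs, tsum_div_const]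
      exact (congrArg ENNReal.ofReal (div_self h)).trans ENNReal.ofReal_one
    exact h1 ▸ ENNReal.summable.hasSum⟩

/-- The transition kernel of the random walk at time `n`: given the path `(Y_0, …, Y_n)`, the
conditional law of `Y_{n+1}` is `step Y_n`. -/
noncomputable def stepKernel [MeasurableSpace V] [DiscreteMeasurableSpace V] (n : ℕ) :
    Kernel (Π _ : Finset.Iic n, V) V where
  toFun past := (G.step (past ⟨n, Finset.mem_Iic.2 le_rfl⟩)).toMeasure
  measurable' := (Measurable.of_discrete (f := fun z => (G.step z).toMeasure)).comp
    (measurable_pi_apply _)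

instance [MeasurableSpace V] [DiscreteMeasurableSpace V] (n : ℕ) :
    IsMarkovKernel (G.stepKernel n) :=
  ⟨fun past => inferInstanceAs (IsProbabilityMeasure (G.step (past ⟨n, _⟩)).toMeasure)⟩

/-- The law, on the path space `ℕ → V`, of the random walk `(Y_n)` started at `x`, i.e. of the
Markov chain with transition probabilities `step` and `Y_0 = x`. -/
noncomputable def walkLaw [MeasurableSpace V] [DiscreteMeasurableSpace V] (x : V) :
    Measure (ℕ → V) :=
  Kernel.traj (X := fun _ => V) G.stepKernel 0 (fun _ => x)

/-- Recurrence of a (connected) graph: for all `x, y`, the random walk started at `x` almost surely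
visits `y` at some time `k > 0`. Here `V` carries the discrete σ-algebra. -/
def IsRecurrent : Prop :=
  letI : MeasurableSpace V := ⊤
  ∀ x y : V, G.walkLaw x {Y | ∃ k > 0, Y k = y} = 1

end WeightedGraph

/-! ## Weighted simplicial complexes -/

/-- `τ ≺ σ`: `τ` is a face of `σ` (and `σ` a coface of `τ`), i.e. `τ ⊆ σ` and `|σ \ τ| = 1`. -/
def IsFace {X : Type*} [DecidableEq X] (τ σ : Finset X) : Prop :=
  τ ⊆ σ ∧ (σ \ τ).card = 1

/-- A simplicial complex (containing the empty simplex) with a positive weight `m` on its simplices.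
Only the values of `m` on simplices are ever used. -/
structure WeightedComplex (X : Type*) where
  /-- all simplices, including the empty one -/
  faces : Set (Finset X)
  empty_mem : ∅ ∈ faces
  down_closed : ∀ ⦃σ τ : Finset X⦄, σ ∈ faces → τ ⊆ σ → τ ∈ faces
  m : Finset X → ℝ
  m_pos : ∀ σ ∈ faces, 0 < m σ

namespace WeightedComplex

variable {X : Type*} (K : WeightedComplex X)

/-- The vertices of the complex have finite total mass. -/
def FiniteVertexMass : Prop := Summable fun v : {v : X // {v} ∈ K.faces} => K.m {v.1}

/-- The simplices that are kept: the empty simplex is discarded unless the vertices have finite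
total mass. -/
def cells : Set (Finset X) := {σ ∈ K.faces | σ = ∅ → K.FiniteVertexMass}

/-- The kept simplices, as a type. -/
abbrev Cell : Type _ := K.cells

variable [DecidableEq X]

/-- Local summability: the cofaces of every (kept) simplex have finite total mass. -/
def LocallySummable : Prop :=
  ∀ τ : K.Cell, Summable fun σ : {σ : K.Cell // IsFace τ.1 σ.1} => K.m σ.1

/-- A coboundary operator: a linear operator `δ` on the complex functions on the simplices with
`δ 1_τ(σ) ∈ {1, -1, 0}`, with `δ 1_τ(σ) ≠ 0` iff `τ ≺ σ`, with `δ δ = 0`, and acting by the finite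
sums `δω(σ) = ∑_{τ ≺ σ} δ1_τ(σ) ω(τ)`. -/
structure Coboundary where
  op : (K.Cell → ℂ) →ₗ[ℂ] (K.Cell → ℂ)
  sign : ∀ τ σ : K.Cell, op (Pi.single τ 1) σ ∈ ({1, -1, 0} : Set ℂ)
  ne_zero_iff : ∀ τ σ : K.Cell, op (Pi.single τ 1) σ ≠ 0 ↔ IsFace τ.1 σ.1
  apply_eq : ∀ (ω : K.Cell → ℂ) (σ : K.Cell),
    op ω σ = ∑ᶠ τ ∈ {τ : K.Cell | IsFace τ.1 σ.1}, op (Pi.single τ 1) σ * ω τ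
  op_op : ∀ ω : K.Cell → ℂ, op (op ω) = 0

variable {K}

/-- The incidence signs `θ(τ, σ) = δ1_τ(σ)`. -/
def Coboundary.θ (δ : K.Coboundary) (τ σ : K.Cell) : ℂ := δ.op (Pi.single τ 1) σ

/-- The boundary operator `∂ω(ρ) = m(ρ)⁻¹ ∑_{τ ≻ ρ} m(τ) θ(ρ, τ) ω(τ)` (meaningful on its
domain, see `boundaryDomain`). -/
noncomputable def Coboundary.boundary (δ : K.Coboundary) (ω : K.Cell → ℂ) : K.Cell → ℂ := fun ρ =>
  (1 / (K.m ρ : ℂ)) * ∑' τ : {τ : K.Cell // IsFace ρ.1 τ.1}, (K.m τ.1 : ℂ) * δ.θ ρ τ.1 * ω τ.1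

variable (K)

/-- The domain `D(∂)`: all `ω` with `∑_{τ ≻ ρ} m(τ) |ω(τ)| < ∞` for every `ρ`. -/
def boundaryDomain : Set (K.Cell → ℂ) :=
  {ω | ∀ ρ : K.Cell, Summable fun τ : {τ : K.Cell // IsFace ρ.1 τ.1} => K.m τ.1 * ‖ω τ.1‖}

/-- The domain `D(∂∂)`: all `ω ∈ D(∂)` with `∂ω ∈ D(∂)`. -/
def boundaryBoundaryDomain (δ : K.Coboundary) : Set (K.Cell → ℂ) :=
  {ω | ω ∈ K.boundaryDomain ∧ δ.boundary ω ∈ K.boundaryDomain}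

/-- The space `ℓ²` of all `ω` with `∑_τ m(τ) |ω(τ)|² < ∞`. -/
def ell2 : Set (K.Cell → ℂ) := {ω | Summable fun τ : K.Cell => K.m τ * ‖ω τ‖ ^ 2}

/-- The link of `ρ`: all vertices `v` such that `v ∪ ρ` is a simplex and a coface of `ρ`. -/
def link (ρ : K.Cell) : Set X :=
  {v | {v} ∈ K.faces ∧ insert v ρ.1 ∈ K.faces ∧ IsFace ρ.1 (insert v ρ.1)}

open Classical in
/-- The edge weights on the link: `b_ρ(v, v') = m(v v' ρ)` for `v ≠ v'` if `v v' ρ` is a simplex,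
and `0` otherwise. -/
noncomputable def linkWeight (ρ : K.Cell) (v v' : K.link ρ) : ℝ :=
  if v ≠ v' ∧ insert v.1 (insert v'.1 ρ.1) ∈ K.faces then K.m (insert v.1 (insert v'.1 ρ.1)) else 0

variable {K}

theorem not_mem_of_mem_link {ρ : K.Cell} {v : X} (hv : v ∈ K.link ρ) : v ∉ ρ.1 := by
  intro h
  have h2 := hv.2.2.2
  rw [Finset.insert_eq_of_mem h] at h2
  simp at h2

theorem insert_mem_cells {τ : Finset X} {v : X} (h : insert v τ ∈ K.faces) :
    insert v τ ∈ K.cells :=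
  ⟨h, fun h0 => absurd h0 (Finset.insert_ne_empty v τ)⟩

theorem isFace_insert {τ : Finset X} {v : X} (h : v ∉ τ) : IsFace τ (insert v τ) :=
  ⟨Finset.subset_insert v τ, by rw [Finset.insert_sdiff_cancel h]; simp⟩

theorem summable_linkWeight (hK : K.LocallySummable) (ρ : K.Cell) (v : K.link ρ) :
    Summable (K.linkWeight ρ v) := by
  classical
  let τ : K.Cell := ⟨insert v.1 ρ.1, insert_mem_cells v.2.2.1⟩
  let s : Set (K.link ρ) := {v' | v ≠ v' ∧ insert v.1 (insert v'.1 ρ.1) ∈ K.faces}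
  have hs : ∀ w : s, w.1.1 ∉ τ.1 := fun w hw => by
    rcases Finset.mem_insert.1 hw with h | h
    · exact w.2.1 (Subtype.ext h.symm)
    · exact not_mem_of_mem_link w.1.2 h
  let e : s → {σ : K.Cell // IsFace τ.1 σ.1} := fun w =>
    ⟨⟨insert w.1.1 τ.1, insert_mem_cells (by
      have := w.2.2
      rwa [Finset.insert_comm] at this)⟩, isFace_insert (hs w)⟩
  have he : Function.Injective e := fun w w' h => by
    have h1 : insert w.1.1 τ.1 = insert w'.1.1 τ.1 := congrArg (fun x => x.1.1) h
    have h2 : w.1.1 ∈ insert w'.1.1 τ.1 := h1 ▸ Finset.mem_insert_self _ _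
    rcases Finset.mem_insert.1 h2 with h3 | h3
    · exact Subtype.ext (Subtype.ext h3)
    · exact absurd h3 (hs w)
  have h1 : Summable fun w : s => K.m (insert v.1 (insert w.1.1 ρ.1)) := by
    refine ((hK τ).comp_injective he).congr fun w => ?_
    simp only [Function.comp, e, τ]
    rw [Finset.insert_comm]
  have h2 := summable_subtype_iff_indicator.1
    (show Summable ((fun v' : K.link ρ => K.m (insert v.1 (insert v'.1 ρ.1))) ∘ ((↑) : s → _))
      from h1)
  refine h2.congr fun w => ?_
  simp only [linkWeight, Set.indicator_apply, s, Set.mem_ofPred_eq]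

/-- The link graph `b_ρ` over `lk(ρ)`. -/
noncomputable def linkGraph (hK : K.LocallySummable) (ρ : K.Cell) : WeightedGraph (K.link ρ) where
  b := K.linkWeight ρ
  nonneg v v' := by
    unfold linkWeight
    split_ifs with h
    · exact (K.m_pos _ h.2).le
    · exact le_rfl
  symm v v' := by
    unfold linkWeight
    rw [Finset.insert_comm]
    classical exact if_congr (and_congr_left' ne_comm) rfl rfl
  diag v := by simp [linkWeight]
  summable := summable_linkWeight hK ρ

end WeightedComplex

/-!
A function `ω` induces a flow `w` on the link graph of `ρ`: up to a sign, the value of `w` on the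
edge `{v, v'}` is `ω(v v' ρ)`, and `δδ = 0` makes `w` antisymmetric. Then
`∂∂ω(ρ) = m(ρ)⁻¹ ∑_v div w(v)`, and the energy of `w` is controlled by the `ℓ²`-norm of `ω`.

If the components of the link graph are recurrent, then the truncated Green's functions
`g_n / g_n(o)`, cut off at `1`, converge to `1` while their energies tend to `0`, because
`g_n(o) → ∞`. Summation by parts against them shows that an antisymmetric flow of finite energy has
total divergence `0`, provided its divergence is summable.

If a component is not recurrent, then Green's function of some vertex `o` with `deg(o) ≠ 0` is
finite, and its gradient is a flow of finite energy with divergence `deg(o) 1_o`. This flow is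
induced by some `ω ∈ ℓ²`, for which `∂∂ω(ρ) = deg(o) / m(ρ)`.
-/

theorem lintegral_pmf_toMeasure {α : Type*} [MeasurableSpace α] [DiscreteMeasurableSpace α]
    (p : PMF α) (f : α → ENNReal) : ∫⁻ a, f a ∂p.toMeasure = ∑' a, p a * f a := by
  have hp : p.toMeasure = Measure.sum fun a => p a • Measure.dirac a := by
    ext s hs
    rw [p.toMeasure_apply hs, Measure.sum_apply _ hs]
    refine tsum_congr fun a => ?_
    rw [Measure.smul_apply, Measure.dirac_apply' _ hs]
    by_cases ha : a ∈ s <;> simp [ha]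
  simp only [hp, lintegral_sum_measure, lintegral_smul_measure,
    lintegral_dirac' _ (Measurable.of_discrete (f := f)), smul_eq_mul]

theorem ennreal_tsum_mul_mul_le_sqrt_mul_sqrt {ι : Type*} (a f g : ι → ENNReal) :
    ∑' i, a i * (f i * g i) ≤
      (∑' i, a i * f i ^ 2) ^ (1 / 2 : ℝ) * (∑' i, a i * g i ^ 2) ^ (1 / 2 : ℝ) := by
  let _ : MeasurableSpace ι := ⊤
  have sqrt_sq (t : ENNReal) : t ^ (1 / 2 : ℝ) * t ^ (1 / 2 : ℝ) = t := by
    rw [← ENNReal.rpow_add_of_nonneg _ _ (by norm_num) (by norm_num), add_halves, ENNReal.rpow_one]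
  have h := ENNReal.lintegral_mul_le_Lp_mul_Lq Measure.count Real.HolderConjugate.two_two
    (Measurable.of_discrete (f := fun i => a i ^ (1 / 2 : ℝ) * f i)).aemeasurable
    (Measurable.of_discrete (f := fun i => a i ^ (1 / 2 : ℝ) * g i)).aemeasurable
  simp only [lintegral_count, Pi.mul_apply, ENNReal.rpow_two, mul_mul_mul_comm _ (f _), mul_pow,
    sq (_ ^ (1 / 2 : ℝ)), sqrt_sq] at h
  exact h

theorem preconnected_induction {V : Type*} {H : SimpleGraph V} (hH : H.Preconnected)
    {p : V → Prop} (hp : ∀ x y, H.Adj x y → p x → p y) {x : V} (hx : p x) (y : V) : p y := by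
  obtain ⟨walk⟩ := hH x y
  induction walk with
  | nil => exact hx
  | cons h _ ih => exact ih (hp _ _ h hx)

namespace WeightedGraph

open Filter Topology
open Finset.HasAntidiagonal (antidiagonal)
open scoped ENNReal

variable {V : Type*} (G : WeightedGraph V)

/-! ## The random walk -/

/-- The transition operator `P g(x) = E[g(Y₁) | Y₀ = x]` of the random walk, acting on functions
with values in `[0, ∞]`, so that all sums converge. -/
noncomputable def transition : (V → ℝ≥0∞) →ₗ[ℝ≥0∞] (V → ℝ≥0∞) where
  toFun g x := ∑' y, G.step x y * g y
  map_add' f g := by ext x; simp only [Pi.add_apply, mul_add, ENNReal.tsum_add]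
  map_smul' a g := by
    ext x
    simp only [Pi.smul_apply, smul_eq_mul, mul_left_comm _ a, ENNReal.tsum_mul_left,
      RingHom.id_apply]

theorem transition_apply (g : V → ℝ≥0∞) (x : V) : G.transition g x = ∑' y, G.step x y * g y :=
  rfl

theorem transition_one : G.transition 1 = 1 := by
  ext x
  simp only [transition_apply, Pi.one_apply, mul_one, (G.step x).tsum_coe]

theorem transition_mono : Monotone G.transition := fun _ _ h _ =>
  ENNReal.tsum_le_tsum fun y => mul_le_mul_right (h y) _

theorem transition_tsum (f : ℕ → V → ℝ≥0∞) (x : V) :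
    G.transition (fun y => ∑' k, f k y) x = ∑' k, G.transition (f k) x := by
  simp only [transition_apply, ← ENNReal.tsum_mul_left]
  exact ENNReal.tsum_comm

theorem step_mul_le_transition (g : V → ℝ≥0∞) (x y : V) :
    G.step x y * g y ≤ G.transition g x :=
  ENNReal.le_tsum (f := fun y => G.step x y * g y) y

/-- The transition operator of the random walk killed when it enters `o`. -/
noncomputable def killed (o : V) (g : V → ℝ≥0∞) : V → ℝ≥0∞ :=
  G.transition (({o}ᶜ : Set V).indicator g)

/-- The probability, as a function of the starting point, that the random walk does not visit `o`
at the times `1, …, n`; see `measure_avoiding`. -/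
noncomputable def survival (o : V) (n : ℕ) : V → ℝ≥0∞ := (G.killed o)^[n] 1

theorem survival_succ (o : V) (n : ℕ) :
    G.survival o (n + 1) = G.killed o (G.survival o n) :=
  Function.iterate_succ_apply' _ _ _

theorem killed_mono (o : V) : Monotone (G.killed o) := fun _ _ h =>
  G.transition_mono (Set.indicator_mono fun x => h x)

theorem killed_one_le (o : V) : G.killed o 1 ≤ 1 :=
  (G.transition_mono (Set.indicator_le_self _ _)).trans_eq G.transition_one

theorem survival_antitone (o : V) : Antitone (G.survival o) :=
  (G.killed_mono o).antitone_iterate_of_map_le (G.killed_one_le o)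

theorem survival_le_one (o : V) (n : ℕ) : G.survival o n ≤ 1 :=
  G.survival_antitone o n.zero_le

/-- The paths up to time `n` which do not visit `o` at a positive time. -/
def avoiding (o : V) (n : ℕ) : Set (Π _ : Finset.Iic n, V) :=
  {p | ∀ k : Finset.Iic n, 0 < k.1 → p k ≠ o}

theorem frestrictLe_mem_avoiding {o : V} {n : ℕ} {Y : ℕ → V} :
    Preorder.frestrictLe n Y ∈ avoiding o n ↔ ∀ k, 0 < k → k ≤ n → Y k ≠ o :=
  ⟨fun h k hk hkn => h ⟨k, Finset.mem_Iic.2 hkn⟩ hk,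
    fun h k hk => h k.1 hk (Finset.mem_Iic.1 k.2)⟩

theorem frestrictLe_succ_mem_avoiding {o : V} {n : ℕ} {Y : ℕ → V} :
    Preorder.frestrictLe (n + 1) Y ∈ avoiding o (n + 1) ↔
      Preorder.frestrictLe n Y ∈ avoiding o n ∧ Y (n + 1) ≠ o := by
  simp only [frestrictLe_mem_avoiding, Nat.le_succ_iff]
  refine ⟨fun h => ⟨fun k hk hkn => h k hk (.inl hkn), h _ n.succ_pos (.inr rfl)⟩, ?_⟩
  rintro ⟨h, h'⟩ k hk (hkn | rfl)
  exacts [h k hk hkn, h']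

section PathSpace

variable [MeasurableSpace V] [DiscreteMeasurableSpace V]

instance (x : V) : IsProbabilityMeasure (G.walkLaw x) :=
  inferInstanceAs (IsProbabilityMeasure (Kernel.traj (X := fun _ => V) G.stepKernel 0 fun _ => x))

theorem measurableSet_avoiding (o : V) (n : ℕ) : MeasurableSet (avoiding o n) := by
  simp only [avoiding, Set.ofPred_forall]
  exact MeasurableSet.iInter fun k => MeasurableSet.iInter fun _ =>
    (measurable_pi_apply (X := fun _ => V) k (measurableSet_singleton o).compl :)

theorem lintegral_walkLaw_zero (x : V) (g : V → ℝ≥0∞) : ∫⁻ Y, g (Y 0) ∂G.walkLaw x = g x := by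
  unfold walkLaw
  rw [Kernel.lintegral_traj (X := fun _ => V) (f := fun Y => g (Y 0)) _
    ((Measurable.of_discrete (f := g)).comp (measurable_pi_apply 0))]
  simp [Function.updateFinset]

theorem lintegral_walkLaw_succ (x : V) (n : ℕ) {F : (Π _ : Finset.Iic n, V) → ℝ≥0∞}
    (hF : Measurable F) (g : V → ℝ≥0∞) :
    ∫⁻ Y, F (Preorder.frestrictLe n Y) * g (Y (n + 1)) ∂G.walkLaw x =
      ∫⁻ Y, F (Preorder.frestrictLe n Y) * G.transition g (Y n) ∂G.walkLaw x := by
  have hg : Measurable g := Measurable.of_discrete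
  have hFg : Measurable fun q : (Π _ : Finset.Iic n, V) × V => F q.1 * g q.2 :=
    (hF.comp measurable_fst).mul (hg.comp measurable_snd)
  have h := congrArg (fun μ => ∫⁻ q, F q.1 * g q.2 ∂μ)
    (Kernel.partialTraj_compProd_eq_map_traj (X := fun _ => V) (κ := G.stepKernel)
      (Nat.zero_le n) (x₀ := fun _ => x))
  rw [Measure.lintegral_compProd hFg, lintegral_map hFg (by fun_prop),
    ← Kernel.traj_map_frestrictLe_apply,
    lintegral_map hFg.lintegral_kernel_prod_right' (by fun_prop)] at h
  refine h.symm.trans (lintegral_congr fun Y => ?_)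
  refine (lintegral_const_mul (F (Preorder.frestrictLe n Y)) hg).trans ?_
  exact congrArg _ (lintegral_pmf_toMeasure _ _)

theorem lintegral_avoiding (o x : V) (n : ℕ) (g : V → ℝ≥0∞) :
    ∫⁻ Y, (avoiding o n).indicator 1 (Preorder.frestrictLe n Y) * g (Y n) ∂G.walkLaw x =
      (G.killed o)^[n] g x := by
  induction n generalizing g with
  | zero =>
    rw [Function.iterate_zero, id, ← G.lintegral_walkLaw_zero x g]
    refine lintegral_congr fun Y => ?_
    have hY : Preorder.frestrictLe 0 Y ∈ avoiding o 0 :=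
      frestrictLe_mem_avoiding.2 fun k hk hk0 => absurd hk (not_lt.2 hk0)
    rw [Set.indicator_of_mem hY, Pi.one_apply, one_mul]
  | succ n ih =>
    rw [Function.iterate_succ_apply, ← ih, killed, ← G.lintegral_walkLaw_succ x n
      (measurable_one.indicator (measurableSet_avoiding o n))]
    refine lintegral_congr fun Y => ?_
    by_cases hY : Preorder.frestrictLe n Y ∈ avoiding o n <;> by_cases ho : Y (n + 1) = o <;>
      simp [frestrictLe_succ_mem_avoiding, hY, ho]

theorem measure_avoiding (o x : V) (n : ℕ) :
    G.walkLaw x (Preorder.frestrictLe n ⁻¹' avoiding o n) = G.survival o n x := by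
  rw [survival, ← lintegral_avoiding,
    ← lintegral_indicator_one ((measurableSet_avoiding o n).preimage (by fun_prop))]
  simp only [Pi.one_apply, mul_one]
  rfl

theorem measure_never_visit (o x : V) :
    G.walkLaw x {Y | ∃ k > 0, Y k = o}ᶜ = ⨅ n, G.survival o n x := by
  have hinter : {Y : ℕ → V | ∃ k > 0, Y k = o}ᶜ =
      ⋂ n, Preorder.frestrictLe (π := fun _ => V) n ⁻¹' avoiding o n := by
    ext Y
    simp only [Set.mem_compl_iff, Set.mem_ofPred_eq, Set.mem_iInter, Set.mem_preimage,
      frestrictLe_mem_avoiding, not_exists, not_and]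
    exact ⟨fun h _ k hk _ => h k hk, fun h k hk => h k k hk le_rfl⟩
  have hanti : Antitone fun n => Preorder.frestrictLe (π := fun _ => V) n ⁻¹' avoiding o n :=
    fun n n' hn Y hY => frestrictLe_mem_avoiding.2 fun k hk hkn =>
      frestrictLe_mem_avoiding.1 hY k hk (hkn.trans hn)
  rw [hinter, hanti.measure_iInter (fun n =>
    ((measurableSet_avoiding o n).preimage (by fun_prop)).nullMeasurableSet)
    ⟨0, measure_ne_top _ _⟩]
  exact iInf_congr (G.measure_avoiding o x)

theorem measurableSet_visit (o : V) : MeasurableSet {Y : ℕ → V | ∃ k > 0, Y k = o} := by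
  simp only [Set.ofPred_exists, gt_iff_lt, Set.ofPred_and]
  exact MeasurableSet.iUnion fun k => (MeasurableSet.const _).inter
    (measurable_pi_apply (X := fun _ => V) k (measurableSet_singleton o) :)

end PathSpace

theorem isRecurrent_iff_iInf_survival :
    G.IsRecurrent ↔ ∀ x o, ⨅ n, G.survival o n x = 0 := by
  let _ : MeasurableSpace V := ⊤
  refine forall₂_congr fun x o => ?_
  rw [← measure_never_visit, prob_compl_eq_zero_iff (measurableSet_visit o)]

/-- The probability, as a function of the starting point, that the random walk is at `o` after `k`
steps. -/
noncomputable def visit (o : V) (k : ℕ) : V → ℝ≥0∞ :=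
  G.transition^[k] (({o} : Set V).indicator 1)

theorem visit_zero (o : V) : G.visit o 0 = ({o} : Set V).indicator 1 := rfl

theorem visit_succ (o : V) (k : ℕ) : G.visit o (k + 1) = G.transition (G.visit o k) :=
  Function.iterate_succ_apply' _ _ _

theorem visit_le_one (o : V) (k : ℕ) : G.visit o k ≤ 1 := by
  induction k with
  | zero => exact Set.indicator_le_self _ _
  | succ k ih =>
    rw [visit_succ]
    exact (G.transition_mono ih).trans_eq G.transition_one

/-- Decomposition according to the last visit to `o` up to time `n`. -/
theorem indicator_survival_add_sum_visit (o : V) (n : ℕ) :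
    ({o}ᶜ : Set V).indicator (G.survival o n) +
      ∑ p ∈ antidiagonal n, G.survival o p.2 o • G.visit o p.1 = 1 := by
  have split_at (g : V → ℝ≥0∞) :
      g = ({o}ᶜ : Set V).indicator g + g o • ({o} : Set V).indicator 1 := by
    ext x
    by_cases hx : x = o <;> simp [hx]
  induction n with
  | zero => simp [visit_zero, survival]
  | succ n ih =>
    have h := congrArg G.transition ih
    simp only [map_add, map_sum, map_smul, transition_one, ← visit_succ] at h
    rw [Finset.Nat.sum_antidiagonal_succ, ← add_assoc, visit_zero, ← split_at, survival_succ]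
    exact h

theorem sum_survival_mul_visit (o : V) (n : ℕ) :
    ∑ k ∈ Finset.range (n + 1), G.survival o (n - k) o * G.visit o k o = 1 := by
  rw [← Nat.succ_eq_add_one, ← Finset.Nat.sum_antidiagonal_eq_sum_range_succ
    fun k l => G.survival o l o * G.visit o k o]
  simpa using congrFun (G.indicator_survival_add_sum_visit o n) o

theorem tsum_visit_mul_iInf_survival_le (o : V) :
    (∑' k, G.visit o k o) * ⨅ n, G.survival o n o ≤ 1 := by
  rw [← ENNReal.tsum_mul_right]
  refine ENNReal.tsum_le_of_sum_range_le fun n => ?_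
  calc ∑ k ∈ Finset.range n, G.visit o k o * ⨅ n, G.survival o n o
      ≤ ∑ k ∈ Finset.range (n + 1), G.visit o k o * ⨅ n, G.survival o n o := by
        gcongr
        exact n.le_succ
    _ ≤ ∑ k ∈ Finset.range (n + 1), G.survival o (n - k) o * G.visit o k o :=
        Finset.sum_le_sum fun k _ => by
          rw [mul_comm]
          gcongr
          exact iInf_le _ _
    _ = 1 := G.sum_survival_mul_visit o n

theorem one_le_mul_survival_add_tsum_visit (o : V) (N M : ℕ) :
    1 ≤ N * G.survival o M o + ∑' k, G.visit o (k + N) o := by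
  rw [← G.sum_survival_mul_visit o (N + M), add_assoc, Finset.sum_range_add]
  refine add_le_add ?_ ?_
  · calc ∑ k ∈ Finset.range N, G.survival o (N + M - k) o * G.visit o k o
        ≤ ∑ _k ∈ Finset.range N, G.survival o M o := Finset.sum_le_sum fun k hk =>
          mul_le_of_le_of_le_one (G.survival_antitone o (by
            have := Finset.mem_range.1 hk
            omega) o) (G.visit_le_one o k o)
      _ = N * G.survival o M o := by simp
  · calc ∑ k ∈ Finset.range (M + 1), G.survival o (N + M - (N + k)) o * G.visit o (N + k) o
        ≤ ∑ k ∈ Finset.range (M + 1), G.visit o (k + N) o := Finset.sum_le_sum fun k _ => by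
          rw [add_comm k N]
          exact mul_le_of_le_one_left' (G.survival_le_one o _ o)
      _ ≤ ∑' k, G.visit o (k + N) o := ENNReal.sum_le_tsum _

theorem tsum_visit_eq_top_iff (o : V) :
    ∑' k, G.visit o k o = ⊤ ↔ ⨅ n, G.survival o n o = 0 := by
  constructor <;> intro h
  · by_contra h0
    have := G.tsum_visit_mul_iInf_survival_le o
    rw [h, ENNReal.top_mul h0] at this
    exact ENNReal.one_ne_top (top_le_iff.1 this)
  · by_contra hfin
    have one_le_tail (N : ℕ) : 1 ≤ ∑' k, G.visit o (k + N) o := by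
      have := le_iInf (G.one_le_mul_survival_add_tsum_visit o N)
      rwa [← ENNReal.iInf_add, ← ENNReal.mul_iInf fun h => absurd h (ENNReal.natCast_ne_top N),
        h, mul_zero, zero_add] at this
    exact one_ne_zero (le_antisymm
      (ge_of_tendsto' (ENNReal.tendsto_sum_nat_add _ hfin) one_le_tail) zero_le)

/-! ## Green's function -/

theorem b_le_deg (x y : V) : G.b x y ≤ G.deg x :=
  (G.summable x).le_tsum y fun z _ => G.nonneg x z

theorem deg_nonneg (x : V) : 0 ≤ G.deg x := tsum_nonneg (G.nonneg x)

theorem tsum_ofReal_b (x : V) : ∑' y, ENNReal.ofReal (G.b x y) = ENNReal.ofReal (G.deg x) :=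
  (ENNReal.ofReal_tsum_of_nonneg (G.nonneg x) (G.summable x)).symm

theorem deg_mul_step (x y : V) :
    ENNReal.ofReal (G.deg x) * G.step x y = ENNReal.ofReal (G.b x y) := by
  by_cases h : G.deg x = 0
  · have hb : G.b x y = 0 := le_antisymm (h ▸ G.b_le_deg x y) (G.nonneg x y)
    simp [h, hb]
  · have hstep : G.step x y = ENNReal.ofReal (G.b x y / G.deg x) :=
      DFunLike.congr_fun (dif_neg h : G.step x = _) y
    rw [hstep, ← ENNReal.ofReal_mul (G.deg_nonneg x), mul_div_cancel₀ _ h]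

theorem step_ne_zero {x y : V} (h : G.toSimpleGraph.Adj x y) : G.step x y ≠ 0 := by
  intro h0
  have hb := G.deg_mul_step x y
  rw [h0, mul_zero, eq_comm, ENNReal.ofReal_eq_zero] at hb
  exact hb.not_gt h

theorem deg_mul_transition (g : V → ℝ≥0∞) (x : V) :
    ENNReal.ofReal (G.deg x) * G.transition g x = ∑' y, ENNReal.ofReal (G.b x y) * g y := by
  simp only [transition_apply, ← ENNReal.tsum_mul_left, ← mul_assoc, deg_mul_step]

theorem tsum_deg_mul_transition (g : V → ℝ≥0∞) :
    ∑' x, ENNReal.ofReal (G.deg x) * G.transition g x = ∑' x, ENNReal.ofReal (G.deg x) * g x := by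
  simp_rw [deg_mul_transition]
  rw [ENNReal.tsum_comm]
  simp_rw [ENNReal.tsum_mul_right, G.symm _, tsum_ofReal_b]

theorem tsum_deg_mul_visit (o : V) (k : ℕ) :
    ∑' x, ENNReal.ofReal (G.deg x) * G.visit o k x = ENNReal.ofReal (G.deg o) := by
  induction k with
  | zero =>
    rw [visit_zero, tsum_eq_single o fun x hx => by simp [hx]]
    simp
  | succ k ih => rw [visit_succ, tsum_deg_mul_transition, ih]

/-- Green's function truncated at time `n`: the expected number of visits to `o` before time `n`,
as a function of the starting point. -/
noncomputable def greenUpTo (o : V) (n : ℕ) : V → ℝ≥0∞ := ∑ k ∈ Finset.range n, G.visit o k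

/-- Green's function: the expected total number of visits to `o`, as a function of the starting
point. -/
noncomputable def green (o x : V) : ℝ≥0∞ := ∑' k, G.visit o k x

theorem greenUpTo_mono (o : V) : Monotone (G.greenUpTo o) := fun _ _ h =>
  Finset.sum_le_sum_of_subset (Finset.range_subset_range.2 h)

theorem greenUpTo_succ (o : V) (n : ℕ) :
    G.greenUpTo o (n + 1) = ({o} : Set V).indicator 1 + G.transition (G.greenUpTo o n) := by
  simp only [greenUpTo, Finset.sum_range_succ', map_sum, ← visit_succ, visit_zero, add_comm]

theorem greenUpTo_le (o : V) (n : ℕ) (x : V) : G.greenUpTo o n x ≤ n := by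
  rw [greenUpTo, Finset.sum_apply]
  exact (Finset.sum_le_card_nsmul _ _ 1 fun k _ => G.visit_le_one o k x).trans (by simp)

theorem greenUpTo_ne_top (o : V) (n : ℕ) (x : V) : G.greenUpTo o n x ≠ ⊤ :=
  ne_top_of_le_ne_top (ENNReal.natCast_ne_top n) (G.greenUpTo_le o n x)

theorem tsum_deg_mul_greenUpTo (o : V) (n : ℕ) :
    ∑' x, ENNReal.ofReal (G.deg x) * G.greenUpTo o n x = n * ENNReal.ofReal (G.deg o) := by
  simp_rw [greenUpTo, Finset.sum_apply, Finset.mul_sum]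
  rw [Summable.tsum_finsetSum fun _ _ => ENNReal.summable]
  simp [tsum_deg_mul_visit]

theorem tendsto_greenUpTo (o x : V) :
    Tendsto (fun n => G.greenUpTo o n x) atTop (𝓝 (G.green o x)) := by
  simpa only [greenUpTo, green, Finset.sum_apply] using
    ENNReal.tendsto_nat_tsum fun k => G.visit o k x

theorem greenUpTo_le_green (o : V) (n : ℕ) (x : V) : G.greenUpTo o n x ≤ G.green o x := by
  rw [greenUpTo, Finset.sum_apply]
  exact ENNReal.sum_le_tsum _

theorem green_eq (o : V) :
    G.green o = ({o} : Set V).indicator 1 + G.transition (G.green o) := by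
  ext x
  rw [green, tsum_eq_zero_add' ENNReal.summable]
  simp only [visit_succ, ← transition_tsum]
  rfl

/-! ## Flows and energy -/

section Flow

variable {E : Type*} [NormedAddCommGroup E]

/-- The energy of a flow `w`, where `w x y` is the value on the oriented edge from `x` to `y` before
multiplication with the weight `b x y`. It takes values in `[0, ∞]`, and every edge is counted
twice, once for each orientation. -/
noncomputable def energy (w : V → V → E) : ℝ≥0∞ :=
  ∑' p : V × V, ENNReal.ofReal (G.b p.1 p.2) * ‖w p.1 p.2‖ₑ ^ 2

/-- The difference operator, turning functions on vertices into flows. -/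
def grad (f : V → E) (x y : V) : E := f x - f y

variable {G}

theorem energy_congr {F : Type*} [NormedAddCommGroup F] {w : V → V → E} {w' : V → V → F}
    (h : ∀ x y, G.b x y ≠ 0 → ‖w x y‖ = ‖w' x y‖) : G.energy w = G.energy w' :=
  tsum_congr fun p => by
    by_cases hp : G.b p.1 p.2 = 0
    · simp [hp]
    · rw [← ofReal_norm, h _ _ hp, ofReal_norm]

theorem energy_le_mul_energy {w w' : V → V → E} {c : ℝ≥0∞}
    (h : ∀ x y, ‖w x y‖ₑ ≤ c * ‖w' x y‖ₑ) : G.energy w ≤ c ^ 2 * G.energy w' := by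
  rw [energy, energy, ← ENNReal.tsum_mul_left]
  refine ENNReal.tsum_le_tsum fun p => ?_
  rw [mul_left_comm, ← mul_pow]
  gcongr
  exact h _ _

theorem energy_le_of_tendsto {w : ℕ → V → V → E} {w' : V → V → E} {c : ℝ≥0∞}
    (hw : ∀ n, G.energy (w n) ≤ c) (h : ∀ x y, Tendsto (fun n => w n x y) atTop (𝓝 (w' x y))) :
    G.energy w' ≤ c := by
  rw [energy, ENNReal.tsum_eq_iSup_sum]
  refine iSup_le fun s => le_of_tendsto'
    (tendsto_finsetSum s fun p _ => ENNReal.Tendsto.const_mul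
      (ENNReal.Tendsto.pow (h p.1 p.2).enorm) (.inr ENNReal.ofReal_ne_top))
    fun n => (ENNReal.sum_le_tsum s).trans (hw n)

theorem enorm_le_sqrt_energy_div (w : V → V → E) {x y : V} (h : G.toSimpleGraph.Adj x y) :
    ‖w x y‖ₑ ≤ (G.energy w / ENNReal.ofReal (G.b x y)) ^ (1 / 2 : ℝ) := by
  rw [one_div, ENNReal.le_rpow_inv_iff two_pos, ENNReal.rpow_two,
    ENNReal.le_div_iff_mul_le (.inl (ENNReal.ofReal_pos.2 h).ne') (.inl ENNReal.ofReal_ne_top),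
    mul_comm]
  exact ENNReal.le_tsum (f := fun p : V × V => ENNReal.ofReal (G.b p.1 p.2) * ‖w p.1 p.2‖ₑ ^ 2)
    (x, y)

variable (G)

theorem energy_fst (u : V → E) :
    G.energy (fun x _ => u x) = ∑' x, ENNReal.ofReal (G.deg x) * ‖u x‖ₑ ^ 2 := by
  rw [energy, ENNReal.tsum_prod']
  simp only [ENNReal.tsum_mul_right, tsum_ofReal_b]

theorem energy_fst_grad_ne_top {u : V → E} (hu : G.energy (fun x _ => u x) ≠ ⊤) :
    G.energy (grad u) ≠ ⊤ := by
  have hswap : G.energy (fun _ y => u y) = G.energy (fun x _ => u x) := by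
    rw [energy, ← (Equiv.prodComm V V).tsum_eq, energy]
    simp only [Equiv.prodComm_apply, Prod.fst_swap, Prod.snd_swap, G.symm _]
  have hle : G.energy (grad u) ≤ 2 * (G.energy (fun x _ => u x) + G.energy (fun _ y => u y)) := by
    simp only [energy, ← ENNReal.tsum_add, ← ENNReal.tsum_mul_left, ← mul_add,
      mul_left_comm (2 : ℝ≥0∞)]
    refine ENNReal.tsum_le_tsum fun p => mul_le_mul_right ?_ _
    refine (pow_le_pow_left₀ zero_le enorm_sub_le 2).trans ?_
    simpa [show (2 : ℝ) - 1 = 1 by norm_num] using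
      ENNReal.rpow_add_le_mul_rpow_add_rpow ‖u p.1‖ₑ ‖u p.2‖ₑ one_le_two
  refine ne_top_of_le_ne_top ?_ hle
  rw [hswap]
  finiteness

variable [NormedSpace ℝ E]

/-- The total outflow of `w` at a vertex. -/
noncomputable def divergence (w : V → V → E) (x : V) : E := ∑' y, G.b x y • w x y

variable {G}

theorem divergence_congr {w w' : V → V → E} {x : V} (h : ∀ y, G.b x y ≠ 0 → w x y = w' x y) :
    G.divergence w x = G.divergence w' x :=
  tsum_congr fun y => by
    by_cases hy : G.b x y = 0
    · simp [hy]
    · rw [h y hy]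

theorem tsum_enorm_smul_smul_le (u : V → V → ℝ) (w : V → V → E) :
    ∑' p : V × V, ‖G.b p.1 p.2 • u p.1 p.2 • w p.1 p.2‖ₑ ≤
      G.energy u ^ (1 / 2 : ℝ) * G.energy w ^ (1 / 2 : ℝ) := by
  simp only [enorm_smul, Real.enorm_eq_ofReal (G.nonneg _ _)]
  exact ennreal_tsum_mul_mul_le_sqrt_mul_sqrt _ _ _

variable [CompleteSpace E]

theorem summable_smul_smul {u : V → V → ℝ} {w : V → V → E} (hu : G.energy u ≠ ⊤)
    (hw : G.energy w ≠ ⊤) : Summable fun p : V × V => G.b p.1 p.2 • u p.1 p.2 • w p.1 p.2 := by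
  refine Summable.of_norm (tsum_enorm_ne_top_iff_summable_norm.1 (ne_top_of_le_ne_top ?_
    (tsum_enorm_smul_smul_le u w)))
  exact ENNReal.mul_ne_top (ENNReal.rpow_ne_top_of_nonneg (by norm_num) hu)
    (ENNReal.rpow_ne_top_of_nonneg (by norm_num) hw)

theorem hasSum_smul_divergence {u : V → ℝ} {w : V → V → E}
    (hu : G.energy (fun x _ => u x) ≠ ⊤) (hw : G.energy w ≠ ⊤) :
    HasSum (fun x => u x • G.divergence w x)
      (∑' p : V × V, G.b p.1 p.2 • u p.1 • w p.1 p.2) := by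
  have h := summable_smul_smul hu hw
  convert h.hasSum.prod_fiberwise fun x => (h.prod_factor x).hasSum using 2 with x
  rw [divergence, ← tsum_const_smul'']
  simp only [smul_comm (u x)]

theorem two_smul_tsum_smul_divergence {u : V → ℝ} {w : V → V → E}
    (hu : G.energy (fun x _ => u x) ≠ ⊤) (hw : G.energy w ≠ ⊤)
    (hanti : ∀ x y, w y x = -w x y) :
    (2 : ℝ) • ∑' x, u x • G.divergence w x =
      ∑' p : V × V, G.b p.1 p.2 • grad u p.1 p.2 • w p.1 p.2 := by
  have hsum := (summable_smul_smul hu hw).hasSum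
  have hswap : HasSum (fun p : V × V => G.b p.1 p.2 • u p.2 • w p.1 p.2)
      (-∑' p : V × V, G.b p.1 p.2 • u p.1 • w p.1 p.2) := by
    rw [← (Equiv.prodComm V V).hasSum_iff]
    convert hsum.neg using 2 with p
    simp [hanti p.1 p.2, G.symm p.2 p.1]
  simp only [grad, sub_smul, smul_sub]
  rw [(hsum.sub hswap).tsum_eq, sub_neg_eq_add, ← two_smul ℝ,
    (hasSum_smul_divergence hu hw).tsum_eq]

end Flow

variable {G}

theorem energy_grad {u : V → ℝ} (hu : G.energy (fun x _ => u x) ≠ ⊤) :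
    G.energy (grad u) = ENNReal.ofReal (2 * ∑' x, u x * G.divergence (grad u) x) := by
  have hgrad := G.energy_fst_grad_ne_top hu
  have hparts := two_smul_tsum_smul_divergence hu hgrad fun x y => (neg_sub (u x) (u y)).symm
  simp only [smul_eq_mul] at hparts
  rw [hparts, ENNReal.ofReal_tsum_of_nonneg
    (fun p => mul_nonneg (G.nonneg _ _) (mul_self_nonneg _)) (summable_smul_smul hgrad hgrad)]
  refine tsum_congr fun p => ?_
  rw [ENNReal.ofReal_mul (G.nonneg _ _), ← sq, ← sq_abs, ENNReal.ofReal_pow (abs_nonneg _),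
    Real.enorm_eq_ofReal_abs]

theorem divergence_grad_toReal {F : V → ℝ≥0∞} (hF : ∀ x, F x ≠ ⊤) {x : V}
    (hPF : G.transition F x ≠ ⊤) :
    G.divergence (grad fun y => (F y).toReal) x =
      G.deg x * ((F x).toReal - (G.transition F x).toReal) := by
  have hsum := G.deg_mul_transition F x
  have hfin : ∑' y, ENNReal.ofReal (G.b x y) * F y ≠ ⊤ :=
    hsum ▸ ENNReal.mul_ne_top ENNReal.ofReal_ne_top hPF
  have hsummable : Summable fun y => G.b x y * (F y).toReal :=
    (ENNReal.summable_toReal hfin).congr fun y => by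
      rw [ENNReal.toReal_mul, ENNReal.toReal_ofReal (G.nonneg x y)]
  have htoReal := congrArg ENNReal.toReal hsum
  rw [ENNReal.tsum_toReal_eq fun y => ENNReal.mul_ne_top ENNReal.ofReal_ne_top (hF y)] at htoReal
  simp only [ENNReal.toReal_mul, ENNReal.toReal_ofReal (G.nonneg _ _),
    ENNReal.toReal_ofReal (G.deg_nonneg _)] at htoReal
  simp only [divergence, grad, smul_eq_mul, mul_sub]
  rw [((G.summable x).mul_right _).tsum_sub hsummable, tsum_mul_right, ← htoReal, deg]

variable (G)

theorem transition_greenUpTo_ne_top (o : V) (n : ℕ) (x : V) :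
    G.transition (G.greenUpTo o n) x ≠ ⊤ :=
  ne_top_of_le_ne_top (G.greenUpTo_ne_top o (n + 1) x) (by
    rw [greenUpTo_succ]
    exact le_add_self)

theorem energy_fst_greenUpTo_ne_top (o : V) (n : ℕ) :
    G.energy (fun x _ => (G.greenUpTo o n x).toReal) ≠ ⊤ := by
  rw [energy_fst]
  have hle : ∑' x, ENNReal.ofReal (G.deg x) * ‖(G.greenUpTo o n x).toReal‖ₑ ^ 2 ≤
      n * ∑' x, ENNReal.ofReal (G.deg x) * G.greenUpTo o n x := by
    rw [← ENNReal.tsum_mul_left]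
    refine ENNReal.tsum_le_tsum fun x => ?_
    rw [Real.enorm_of_nonneg ENNReal.toReal_nonneg,
      ENNReal.ofReal_toReal (G.greenUpTo_ne_top o n x), mul_left_comm, sq]
    gcongr
    exact G.greenUpTo_le o n x
  refine ne_top_of_le_ne_top ?_ hle
  rw [tsum_deg_mul_greenUpTo]
  finiteness

theorem divergence_grad_greenUpTo_le (o : V) (n : ℕ) (x : V) :
    G.divergence (grad fun y => (G.greenUpTo o n y).toReal) x ≤
      ({o} : Set V).indicator G.deg x := by
  rw [divergence_grad_toReal (G.greenUpTo_ne_top o n) (G.transition_greenUpTo_ne_top o n x)]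
  have htransition := G.transition_greenUpTo_ne_top o n x
  have hle := G.greenUpTo_mono o n.le_succ x
  rw [Nat.succ_eq_add_one, greenUpTo_succ, Pi.add_apply] at hle
  rcases eq_or_ne x o with rfl | hx
  · rw [Set.indicator_of_mem (Set.mem_singleton x), Pi.one_apply] at hle
    have := ENNReal.toReal_mono (by finiteness) hle
    rw [ENNReal.toReal_add ENNReal.one_ne_top htransition, ENNReal.toReal_one] at this
    rw [Set.indicator_of_mem (Set.mem_singleton x)]
    exact mul_le_of_le_one_right (G.deg_nonneg x) (by linarith)
  · rw [Set.indicator_of_notMem (mt Set.mem_singleton_iff.1 hx), zero_add] at hle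
    have := ENNReal.toReal_mono htransition hle
    simpa [hx] using mul_nonpos_of_nonneg_of_nonpos (G.deg_nonneg x) (sub_nonpos.2 this)

theorem energy_grad_greenUpTo_le (o : V) (n : ℕ) :
    G.energy (grad fun x => (G.greenUpTo o n x).toReal) ≤
      2 * (ENNReal.ofReal (G.deg o) * G.greenUpTo o n o) := by
  set u : V → ℝ := fun x => (G.greenUpTo o n x).toReal
  have henergy := G.energy_fst_greenUpTo_ne_top o n
  have hle : ∑' x, u x * G.divergence (grad u) x ≤ u o * G.deg o := by
    have hsum := (hasSum_smul_divergence henergy (G.energy_fst_grad_ne_top henergy)).summable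
    have hsingle := hasSum_single (f := fun x => u x * ({o} : Set V).indicator G.deg x) o
      fun x hx => by simp [hx]
    rw [Set.indicator_of_mem (Set.mem_singleton o)] at hsingle
    exact hasSum_le (fun x => mul_le_mul_of_nonneg_left
      (G.divergence_grad_greenUpTo_le o n x) ENNReal.toReal_nonneg) hsum.hasSum hsingle
  calc G.energy (grad u) = ENNReal.ofReal (2 * ∑' x, u x * G.divergence (grad u) x) :=
        energy_grad henergy
    _ ≤ ENNReal.ofReal (2 * (G.deg o * u o)) := by
        gcongr
        rwa [mul_comm (G.deg o)]
    _ = 2 * (ENNReal.ofReal (G.deg o) * G.greenUpTo o n o) := by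
        rw [ENNReal.ofReal_mul zero_le_two, ENNReal.ofReal_mul (G.deg_nonneg o),
          ENNReal.ofReal_toReal (G.greenUpTo_ne_top o n o), ENNReal.ofReal_ofNat]

variable {G}

/-! ## Recurrent graphs -/

/-- A null sequence of `G`: functions with values in `[0, 1]`, square summable with respect to
`deg`, which converge to `1` pointwise while their energies tend to `0`. -/
structure IsNullSequence (G : WeightedGraph V) (e : ℕ → V → ℝ) : Prop where
  nonneg : ∀ n x, 0 ≤ e n x
  le_one : ∀ n x, e n x ≤ 1
  energy_ne_top : ∀ n, G.energy (fun x _ => e n x) ≠ ⊤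
  tendsto_energy : Tendsto (fun n => G.energy (grad (e n))) atTop (𝓝 0)
  tendsto_one : ∀ x, Tendsto (fun n => e n x) atTop (𝓝 1)

theorem tendsto_of_tendsto_energy_grad (hc : G.toSimpleGraph.Preconnected) {e : ℕ → V → ℝ}
    (hE : Tendsto (fun n => G.energy (grad (e n))) atTop (𝓝 0)) {o : V} {a : ℝ}
    (ho : Tendsto (fun n => e n o) atTop (𝓝 a)) (x : V) :
    Tendsto (fun n => e n x) atTop (𝓝 a) := by
  refine preconnected_induction hc (p := fun x => Tendsto (fun n => e n x) atTop (𝓝 a))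
    (fun x y hxy hx => ?_) ho x
  have hbound : Tendsto (fun n => (G.energy (grad (e n)) / ENNReal.ofReal (G.b x y)) ^ (1 / 2 : ℝ))
      atTop (𝓝 0) := by
    have := (ENNReal.continuous_rpow_const (y := 1 / 2)).tendsto _ |>.comp
      (ENNReal.Tendsto.div_const hE (.inr (ENNReal.ofReal_pos.2 hxy).ne'))
    simpa [Function.comp_def] using this
  have hdiff : Tendsto (fun n => e n x - e n y) atTop (𝓝 0) :=
    tendsto_zero_iff_enorm_tendsto_zero.2 (tendsto_of_tendsto_of_tendsto_of_le_of_le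
      tendsto_const_nhds hbound (fun _ => zero_le) fun n => enorm_le_sqrt_energy_div _ hxy)
  simpa using hx.sub hdiff

variable (G)

/-- Green's function truncated at time `n + 1`, normalised to be `1` at `o` and cut off at `1`. The
shift in time makes the normalising constant positive. -/
noncomputable def nullSequence (o : V) (n : ℕ) (x : V) : ℝ :=
  min 1 ((G.greenUpTo o (n + 1) x).toReal / (G.greenUpTo o (n + 1) o).toReal)

theorem greenUpTo_succ_self_ne_zero (o : V) (n : ℕ) : G.greenUpTo o (n + 1) o ≠ 0 := by
  simp [greenUpTo_succ]

theorem enorm_inv_greenUpTo (o : V) (n : ℕ) :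
    ‖(G.greenUpTo o (n + 1) o).toReal⁻¹‖ₑ = (G.greenUpTo o (n + 1) o)⁻¹ := by
  rw [← ENNReal.toReal_inv, Real.enorm_of_nonneg ENNReal.toReal_nonneg,
    ENNReal.ofReal_toReal (ENNReal.inv_ne_top.2 (G.greenUpTo_succ_self_ne_zero o n))]

theorem nullSequence_nonneg (o : V) (n : ℕ) (x : V) : 0 ≤ G.nullSequence o n x :=
  le_min zero_le_one (div_nonneg ENNReal.toReal_nonneg ENNReal.toReal_nonneg)

theorem nullSequence_self (o : V) (n : ℕ) : G.nullSequence o n o = 1 := by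
  rw [nullSequence, div_self (ENNReal.toReal_ne_zero.2
    ⟨G.greenUpTo_succ_self_ne_zero o n, G.greenUpTo_ne_top o _ o⟩), min_self]

theorem energy_nullSequence_ne_top (o : V) (n : ℕ) :
    G.energy (fun x _ => G.nullSequence o n x) ≠ ⊤ := by
  refine ne_top_of_le_ne_top ?_ (energy_le_mul_energy (c := (G.greenUpTo o (n + 1) o)⁻¹)
    (w' := fun x _ => (G.greenUpTo o (n + 1) x).toReal) fun x _ => ?_)
  · exact ENNReal.mul_ne_top (ENNReal.pow_ne_top (ENNReal.inv_ne_top.2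
      (G.greenUpTo_succ_self_ne_zero o n))) (G.energy_fst_greenUpTo_ne_top o _)
  · rw [← enorm_inv_greenUpTo, ← enorm_mul, ← div_eq_inv_mul,
      Real.enorm_of_nonneg (G.nullSequence_nonneg o n x),
      Real.enorm_of_nonneg (div_nonneg ENNReal.toReal_nonneg ENNReal.toReal_nonneg)]
    exact ENNReal.ofReal_le_ofReal (min_le_right _ _)

theorem energy_grad_nullSequence_le (o : V) (n : ℕ) :
    G.energy (grad (G.nullSequence o n)) ≤
      2 * ENNReal.ofReal (G.deg o) * (G.greenUpTo o (n + 1) o)⁻¹ := by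
  have hle (x y : V) : ‖grad (G.nullSequence o n) x y‖ₑ ≤ (G.greenUpTo o (n + 1) o)⁻¹ *
      ‖grad (fun x => (G.greenUpTo o (n + 1) x).toReal) x y‖ₑ := by
    rw [← enorm_inv_greenUpTo, ← enorm_mul, grad, grad, ← div_eq_inv_mul, sub_div,
      Real.enorm_eq_ofReal_abs, Real.enorm_eq_ofReal_abs]
    refine ENNReal.ofReal_le_ofReal ((abs_min_sub_min_le_max _ _ _ _).trans ?_)
    simp
  refine (energy_le_mul_energy hle).trans ?_
  calc (G.greenUpTo o (n + 1) o)⁻¹ ^ 2 *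
        G.energy (grad fun x => (G.greenUpTo o (n + 1) x).toReal)
      ≤ (G.greenUpTo o (n + 1) o)⁻¹ ^ 2 *
        (2 * (ENNReal.ofReal (G.deg o) * G.greenUpTo o (n + 1) o)) := by
        gcongr
        exact G.energy_grad_greenUpTo_le o (n + 1)
    _ = 2 * ENNReal.ofReal (G.deg o) * (G.greenUpTo o (n + 1) o)⁻¹ *
        ((G.greenUpTo o (n + 1) o)⁻¹ * G.greenUpTo o (n + 1) o) := by ring
    _ = 2 * ENNReal.ofReal (G.deg o) * (G.greenUpTo o (n + 1) o)⁻¹ := by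
        rw [ENNReal.inv_mul_cancel (G.greenUpTo_succ_self_ne_zero o n)
          (G.greenUpTo_ne_top o _ o), mul_one]

variable {G}

theorem IsRecurrent.green_self (hG : G.IsRecurrent) (o : V) : G.green o o = ⊤ :=
  (G.tsum_visit_eq_top_iff o).2 (G.isRecurrent_iff_iInf_survival.1 hG o o)

theorem IsRecurrent.isNullSequence (hG : G.IsRecurrent) (hc : G.toSimpleGraph.Preconnected)
    (o : V) : G.IsNullSequence (G.nullSequence o) := by
  have hgreen : Tendsto (fun n => (G.greenUpTo o (n + 1) o)⁻¹) atTop (𝓝 0) := by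
    rw [← ENNReal.inv_top, ← hG.green_self o]
    exact tendsto_inv_iff.2 ((tendsto_add_atTop_iff_nat 1).2 (G.tendsto_greenUpTo o o))
  have henergy : Tendsto (fun n => G.energy (grad (G.nullSequence o n))) atTop (𝓝 0) := by
    refine tendsto_of_tendsto_of_tendsto_of_le_of_le tendsto_const_nhds ?_ (fun _ => zero_le)
      (G.energy_grad_nullSequence_le o)
    simpa using ENNReal.Tendsto.const_mul hgreen (.inr (by finiteness))
  exact ⟨G.nullSequence_nonneg o, fun _ _ => min_le_left _ _, G.energy_nullSequence_ne_top o,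
    henergy, tendsto_of_tendsto_energy_grad hc henergy (o := o)
      (by simp only [nullSequence_self, tendsto_const_nhds])⟩

theorem IsNullSequence.tsum_divergence_eq_zero {E : Type*} [NormedAddCommGroup E]
    [NormedSpace ℝ E] [CompleteSpace E] {e : ℕ → V → ℝ} (he : G.IsNullSequence e)
    {w : V → V → E} (hanti : ∀ x y, w y x = -w x y) (hw : G.energy w ≠ ⊤)
    (hdiv : Summable fun x => ‖G.divergence w x‖) : ∑' x, G.divergence w x = 0 := by
  have htsum : Tendsto (fun n => ∑' x, e n x • G.divergence w x) atTop
      (𝓝 (∑' x, G.divergence w x)) := by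
    refine tendsto_tsum_of_dominated_convergence hdiv
      (fun x => by simpa using (he.tendsto_one x).smul_const (G.divergence w x))
      (Eventually.of_forall fun n x => ?_)
    rw [norm_smul, Real.norm_of_nonneg (he.nonneg n x)]
    exact mul_le_of_le_one_left (norm_nonneg _) (he.le_one n x)
  have hbound : Tendsto (fun n => G.energy (grad (e n)) ^ (1 / 2 : ℝ) * G.energy w ^ (1 / 2 : ℝ))
      atTop (𝓝 0) := by
    have := (ENNReal.continuous_rpow_const (y := 1 / 2)).tendsto _ |>.comp he.tendsto_energy
    simpa using ENNReal.Tendsto.mul_const this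
      (.inr (ENNReal.rpow_ne_top_of_nonneg (by norm_num) hw))
  have hzero : Tendsto (fun n => (2 : ℝ) • ∑' x, e n x • G.divergence w x) atTop (𝓝 0) := by
    refine tendsto_zero_iff_enorm_tendsto_zero.2 (tendsto_of_tendsto_of_tendsto_of_le_of_le
      tendsto_const_nhds hbound (fun _ => zero_le) fun n => ?_)
    rw [two_smul_tsum_smul_divergence (he.energy_ne_top n) hw hanti]
    exact enorm_tsum_le_tsum_enorm.trans (tsum_enorm_smul_smul_le _ _)
  simpa using tendsto_nhds_unique (htsum.const_smul (2 : ℝ)) hzero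

theorem IsRecurrent.tsum_divergence_eq_zero {E : Type*} [NormedAddCommGroup E]
    [NormedSpace ℝ E] [CompleteSpace E] (hG : G.IsRecurrent) (hc : G.toSimpleGraph.Preconnected)
    {w : V → V → E} (hanti : ∀ x y, w y x = -w x y) (hw : G.energy w ≠ ⊤)
    (hdiv : Summable fun x => ‖G.divergence w x‖) : ∑' x, G.divergence w x = 0 := by
  rcases isEmpty_or_nonempty V with hV | ⟨⟨o⟩⟩
  · exact tsum_empty
  · exact (hG.isNullSequence hc o).tsum_divergence_eq_zero hanti hw hdiv

/-! ## Transient graphs -/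

theorem iInf_survival_eq_zero_of_self (hc : G.toSimpleGraph.Preconnected) {o : V}
    (ho : ⨅ n, G.survival o n o = 0) (x : V) : ⨅ n, G.survival o n x = 0 := by
  refine preconnected_induction hc (p := fun x => ⨅ n, G.survival o n x = 0)
    (fun x y hxy hx => ?_) ho x
  by_cases hy : y = o
  · rw [hy, ho]
  have hle : G.step x y * ⨅ n, G.survival o n y ≤ ⨅ n, G.survival o n x := by
    refine le_iInf fun n => ?_
    calc G.step x y * ⨅ n, G.survival o n y
        ≤ G.step x y * ({o}ᶜ : Set V).indicator (G.survival o n) y := by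
          rw [Set.indicator_of_mem hy]
          gcongr
          exact iInf_le _ n
      _ ≤ G.survival o (n + 1) x := by
          rw [survival_succ]
          exact G.step_mul_le_transition _ x y
      _ ≤ G.survival o n x := G.survival_antitone o n.le_succ x
  rw [hx, nonpos_iff_eq_zero, mul_eq_zero] at hle
  exact hle.resolve_left (G.step_ne_zero hxy)

theorem exists_green_self_ne_top (hG : ¬G.IsRecurrent) (hc : G.toSimpleGraph.Preconnected) :
    ∃ o, G.green o o ≠ ⊤ := by
  contrapose! hG
  refine G.isRecurrent_iff_iInf_survival.2 fun x o => ?_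
  exact iInf_survival_eq_zero_of_self hc ((G.tsum_visit_eq_top_iff o).1 (hG o)) x

theorem green_ne_top (hc : G.toSimpleGraph.Preconnected) {o : V} (ho : G.green o o ≠ ⊤) (x : V) :
    G.green o x ≠ ⊤ := by
  refine preconnected_induction hc (p := fun x => G.green o x ≠ ⊤) (fun x y hxy hx hy => hx ?_) ho x
  rw [← top_le_iff]
  calc ⊤ = G.step x y * G.green o y := by rw [hy, ENNReal.mul_top (G.step_ne_zero hxy)]
    _ ≤ G.transition (G.green o) x := G.step_mul_le_transition _ x y
    _ ≤ G.green o x := by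
      rw [congrFun (G.green_eq o) x]
      exact le_add_self

theorem green_self_eq_top_of_deg_eq_zero {o : V} (ho : G.deg o = 0) : G.green o o = ⊤ := by
  have hstep : G.step o = PMF.pure o := dif_pos ho
  have hvisit (k : ℕ) : G.visit o k o = 1 := by
    induction k with
    | zero => simp [visit_zero]
    | succ k ih =>
      rw [visit_succ, transition_apply, hstep, tsum_eq_single o fun y hy => by simp [hy], ih]
      simp
  simp only [green, hvisit]
  exact ENNReal.tsum_const_eq_top_of_ne_zero one_ne_zero

theorem energy_grad_green_ne_top {o : V} (ho : ∀ x, G.green o x ≠ ⊤) :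
    G.energy (grad fun x => (G.green o x).toReal) ≠ ⊤ := by
  have hlim (x : V) : Tendsto (fun n => (G.greenUpTo o n x).toReal) atTop
      (𝓝 (G.green o x).toReal) :=
    (ENNReal.tendsto_toReal (ho x)).comp (G.tendsto_greenUpTo o x)
  have hle (n : ℕ) : G.energy (grad fun x => (G.greenUpTo o n x).toReal) ≤
      2 * (ENNReal.ofReal (G.deg o) * G.green o o) := by
    refine (G.energy_grad_greenUpTo_le o n).trans ?_
    gcongr
    exact G.greenUpTo_le_green o n o
  refine ne_top_of_le_ne_top ?_ (energy_le_of_tendsto hle fun x y => (hlim x).sub (hlim y))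
  have := ho o
  finiteness

theorem divergence_grad_green {o : V} (ho : ∀ x, G.green o x ≠ ⊤) :
    G.divergence (grad fun x => (G.green o x).toReal) = ({o} : Set V).indicator G.deg := by
  ext x
  have hgreen := congrFun (G.green_eq o) x
  rw [Pi.add_apply] at hgreen
  obtain ⟨hindicator, htransition⟩ := ENNReal.add_ne_top.1 (hgreen ▸ ho x)
  rw [divergence_grad_toReal ho htransition, hgreen, ENNReal.toReal_add hindicator htransition,
    add_sub_cancel_right]
  by_cases hx : x = o <;> simp [hx]

theorem exists_potential_of_not_isRecurrent (hG : ¬G.IsRecurrent)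
    (hc : G.toSimpleGraph.Preconnected) :
    ∃ (f : V → ℝ) (o : V), G.deg o ≠ 0 ∧ G.energy (grad f) ≠ ⊤ ∧
      G.divergence (grad f) = ({o} : Set V).indicator G.deg := by
  obtain ⟨o, ho⟩ := exists_green_self_ne_top hG hc
  have hgreen := green_ne_top hc ho
  exact ⟨fun x => (G.green o x).toReal, o, mt green_self_eq_top_of_deg_eq_zero ho,
    energy_grad_green_ne_top hgreen, divergence_grad_green hgreen⟩

/-! ## Connected components -/

theorem energy_induce_le {E : Type*} [NormedAddCommGroup E] (s : Set V) (w : V → V → E) :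
    (G.induce s).energy (fun x y => w x y) ≤ G.energy w :=
  ENNReal.tsum_comp_le_tsum_of_injective
    (Subtype.val_injective.prodMap Subtype.val_injective)
    fun p : V × V => ENNReal.ofReal (G.b p.1 p.2) * ‖w p.1 p.2‖ₑ ^ 2

section Component

variable (C : G.toSimpleGraph.ConnectedComponent)

theorem preconnected_induce_supp : (G.induce C.supp).toSimpleGraph.Preconnected :=
  C.connected_toSimpleGraph.preconnected

theorem mem_supp_congr {x y : V} (h : G.b x y ≠ 0) : x ∈ C.supp ↔ y ∈ C.supp :=
  C.mem_supp_congr_adj (lt_of_le_of_ne (G.nonneg x y) h.symm)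

theorem divergence_induce_supp {E : Type*} [NormedAddCommGroup E] [NormedSpace ℝ E]
    (w : V → V → E) (x : C.supp) :
    (G.induce C.supp).divergence (fun y z => w y z) x = G.divergence w x := by
  refine tsum_subtype_eq_of_support_subset (f := fun y => G.b x y • w x y) fun y hy => ?_
  exact (mem_supp_congr C (left_ne_zero_of_smul hy)).1 x.2

variable (f : C.supp → ℝ)

theorem grad_extend_supp_eq_zero {x y : V} (h : G.b x y ≠ 0) (hx : x ∉ C.supp) :
    grad (Function.extend Subtype.val f 0) x y = 0 := by
  have hy := mt (mem_supp_congr C h).2 hx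
  rw [grad, Function.extend_apply' _ _ _ (by simpa using hx),
    Function.extend_apply' _ _ _ (by simpa using hy), Pi.zero_apply, Pi.zero_apply, sub_self]

theorem energy_grad_extend_supp :
    G.energy (grad (Function.extend Subtype.val f 0)) = (G.induce C.supp).energy (grad f) := by
  refine ((Subtype.val_injective.prodMap Subtype.val_injective).tsum_eq fun p hp => ?_).symm.trans
    (tsum_congr fun p => ?_)
  · have hb : G.b p.1 p.2 ≠ 0 := fun h => hp (by simp [h])
    have hx : p.1 ∈ C.supp := by
      by_contra hx
      exact hp (by simp [grad_extend_supp_eq_zero C f hb hx])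
    exact ⟨(⟨p.1, hx⟩, ⟨p.2, (mem_supp_congr C hb).1 hx⟩), rfl⟩
  · simp only [Prod.map_fst, Prod.map_snd, grad, Subtype.val_injective.extend_apply]
    rfl

theorem divergence_grad_extend_supp :
    G.divergence (grad (Function.extend Subtype.val f 0)) =
      Function.extend Subtype.val ((G.induce C.supp).divergence (grad f)) 0 := by
  ext x
  by_cases hx : x ∈ C.supp
  · lift x to C.supp using hx
    rw [Subtype.val_injective.extend_apply, ← divergence_induce_supp]
    simp only [grad, Subtype.val_injective.extend_apply]
    rfl
  · rw [Function.extend_apply' _ _ _ (by simpa using hx),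
      divergence_congr (w' := 0) fun y h => grad_extend_supp_eq_zero C f h hx]
    simp [divergence]

end Component

theorem tsum_divergence_eq_zero_of_forall_isRecurrent {E : Type*} [NormedAddCommGroup E]
    [NormedSpace ℝ E] [CompleteSpace E]
    (hG : ∀ C : G.toSimpleGraph.ConnectedComponent, (G.induce C.supp).IsRecurrent)
    {w : V → V → E} (hanti : ∀ x y, w y x = -w x y) (hw : G.energy w ≠ ⊤)
    (hdiv : Summable fun x => ‖G.divergence w x‖) : ∑' x, G.divergence w x = 0 := by
  let fiberEquiv := Equiv.sigmaFiberEquiv G.toSimpleGraph.connectedComponentMk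
  have hsummable : Summable fun q => G.divergence w (fiberEquiv q) :=
    fiberEquiv.summable_iff.2 hdiv.of_norm
  rw [← fiberEquiv.tsum_eq, hsummable.tsum_sigma]
  refine (tsum_congr fun C => ?_).trans tsum_zero
  have hzero := (hG C).tsum_divergence_eq_zero (preconnected_induce_supp C)
    (w := fun y z => w y z) (fun x y => hanti x y) (ne_top_of_le_ne_top hw (energy_induce_le _ w))
  simp only [divergence_induce_supp] at hzero
  exact hzero (hdiv.comp_injective Subtype.val_injective)

theorem exists_potential_of_not_forall_isRecurrent
    (hG : ¬∀ C : G.toSimpleGraph.ConnectedComponent, (G.induce C.supp).IsRecurrent) :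
    ∃ (f : V → ℝ) (o : V) (c : ℝ), c ≠ 0 ∧ G.energy (grad f) ≠ ⊤ ∧
      G.divergence (grad f) = ({o} : Set V).indicator fun _ => c := by
  obtain ⟨C, hC⟩ := not_forall.1 hG
  obtain ⟨f, o, ho, henergy, hdiv⟩ :=
    exists_potential_of_not_isRecurrent hC (preconnected_induce_supp C)
  refine ⟨Function.extend Subtype.val f 0, o, (G.induce C.supp).deg o, ho, ?_, ?_⟩
  · rwa [energy_grad_extend_supp]
  rw [divergence_grad_extend_supp, hdiv]
  ext x
  by_cases hx : x ∈ C.supp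
  · lift x to C.supp using hx
    rw [Subtype.val_injective.extend_apply]
    rcases eq_or_ne x o with rfl | hxo
    · simp
    · simp [hxo, Subtype.coe_injective.ne hxo]
  · rw [Function.extend_apply' _ _ _ (by simpa using hx), Pi.zero_apply,
      Set.indicator_of_notMem (by rintro rfl; exact hx o.2)]

theorem energy_grad_ofReal (f : V → ℝ) :
    G.energy (grad fun x => (f x : ℂ)) = G.energy (grad f) :=
  energy_congr fun x y _ => by
    simp only [grad, ← Complex.ofReal_sub, Complex.norm_real]

theorem divergence_grad_ofReal (f : V → ℝ) (x : V) :
    G.divergence (grad fun x => (f x : ℂ)) x = ↑(G.divergence (grad f) x) := by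
  simp only [divergence, grad, Complex.ofReal_tsum, smul_eq_mul, Complex.ofReal_mul,
    Complex.ofReal_sub, Complex.real_smul]

end WeightedGraph

theorem isFace_iff_covBy {X : Type*} [DecidableEq X] {τ σ : Finset X} : IsFace τ σ ↔ τ ⋖ σ :=
  Finset.covBy_iff_card_sdiff_eq_one.symm

theorem isFace_iff_card {X : Type*} [DecidableEq X] {τ σ : Finset X} :
    IsFace τ σ ↔ τ ⊆ σ ∧ σ.card = τ.card + 1 :=
  and_congr_right fun h => by
    have := Finset.card_le_card h
    rw [Finset.card_sdiff_of_subset h]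
    lia

theorem summable_mul_norm_pow_iff {ι E : Type*} [SeminormedAddCommGroup E] {a : ι → ℝ}
    (ha : ∀ i, 0 ≤ a i) (f : ι → E) (k : ℕ) :
    (Summable fun i => a i * ‖f i‖ ^ k) ↔ ∑' i, ENNReal.ofReal (a i) * ‖f i‖ₑ ^ k ≠ ⊤ := by
  rw [← summable_norm_iff, ← tsum_enorm_ne_top_iff_summable_norm]
  simp only [enorm_mul, enorm_pow, enorm_norm, Real.enorm_of_nonneg (ha _)]

namespace WeightedComplex

open scoped ENNReal

variable {X : Type*} {K : WeightedComplex X}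

theorem m_cell_pos (σ : K.Cell) : 0 < K.m σ :=
  K.m_pos _ σ.2.1

theorem mem_ell2_iff {ω : K.Cell → ℂ} :
    ω ∈ K.ell2 ↔ ∑' σ : K.Cell, ENNReal.ofReal (K.m σ) * ‖ω σ‖ₑ ^ 2 ≠ ⊤ :=
  summable_mul_norm_pow_iff (fun σ => (m_cell_pos σ).le) ω 2

variable [DecidableEq X]

/-! ## The link graph -/

theorem mem_link_of_insert_mem_faces {ρ : K.Cell} {v : X} (hv : v ∉ ρ.1)
    (h : insert v ρ.1 ∈ K.faces) : v ∈ K.link ρ :=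
  ⟨K.down_closed h (Finset.singleton_subset_iff.2 (Finset.mem_insert_self _ _)), h,
    isFace_insert hv⟩

/-- The coface `v ∪ ρ` of `ρ` given by a vertex `v` of the link. -/
def cone (ρ : K.Cell) (v : K.link ρ) : K.Cell := ⟨insert v.1 ρ.1, insert_mem_cells v.2.2.1⟩

theorem isFace_cone (ρ : K.Cell) (v : K.link ρ) : IsFace ρ.1 (cone ρ v).1 := v.2.2.2

theorem cone_injective (ρ : K.Cell) : Function.Injective (cone ρ) := fun v _ h =>
  Subtype.ext ((Finset.insert_inj (not_mem_of_mem_link v.2)).1 (congrArg Subtype.val h))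

theorem exists_cone_eq {ρ τ : K.Cell} (h : IsFace ρ.1 τ.1) : ∃ v, cone ρ v = τ := by
  obtain ⟨v, hv, hτ⟩ := (isFace_iff_covBy.1 h).exists_finset_insert
  exact ⟨⟨v, mem_link_of_insert_mem_faces hv (hτ ▸ τ.2.1)⟩, Subtype.ext hτ⟩

/-- The vertices of the link of `ρ` correspond to the cofaces of `ρ`. -/
noncomputable def coneEquiv (ρ : K.Cell) : K.link ρ ≃ {τ : K.Cell // IsFace ρ.1 τ.1} :=
  Equiv.ofBijective (fun v => ⟨cone ρ v, isFace_cone ρ v⟩)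
    ⟨fun _ _ h => cone_injective ρ (congrArg Subtype.val h), fun τ =>
      (exists_cone_eq τ.2).imp fun _ => Subtype.ext⟩

@[simp]
theorem coe_coneEquiv (ρ : K.Cell) (v : K.link ρ) : (coneEquiv ρ v : K.Cell) = cone ρ v := rfl

/-- Adjacency in the link graph. -/
def LinkAdj (ρ : K.Cell) (v w : K.link ρ) : Prop :=
  v ≠ w ∧ insert v.1 (insert w.1 ρ.1) ∈ K.faces

open Classical in
/-- The simplex `{v, w} ∪ ρ` for adjacent vertices `v, w` of the link; the value `ρ` for
`{v, w} ∪ ρ` not a simplex is a dummy. -/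
noncomputable def join (ρ : K.Cell) (v w : K.link ρ) : K.Cell :=
  if h : insert v.1 (insert w.1 ρ.1) ∈ K.faces then ⟨_, insert_mem_cells h⟩ else ρ

namespace LinkAdj

variable {ρ : K.Cell} {v w : K.link ρ}

theorem symm (h : LinkAdj ρ v w) : LinkAdj ρ w v :=
  ⟨h.1.symm, by rw [Finset.insert_comm]; exact h.2⟩

theorem coe_join (h : LinkAdj ρ v w) : (join ρ v w).1 = insert v.1 (insert w.1 ρ.1) := by
  rw [join, dif_pos h.2]

theorem coe_join_eq_insert_cone (h : LinkAdj ρ v w) :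
    (join ρ v w).1 = insert w.1 (cone ρ v).1 := by
  rw [h.coe_join, Finset.insert_comm, cone]

theorem join_comm (h : LinkAdj ρ v w) : join ρ v w = join ρ w v :=
  Subtype.ext (by rw [h.coe_join_eq_insert_cone, h.symm.coe_join, cone])

theorem notMem_cone (h : LinkAdj ρ v w) : w.1 ∉ (cone ρ v).1 := fun hw =>
  (Finset.mem_insert.1 hw).elim (fun heq => h.1 (Subtype.ext heq.symm)) (not_mem_of_mem_link w.2)

theorem isFace_cone_join (h : LinkAdj ρ v w) : IsFace (cone ρ v).1 (join ρ v w).1 := by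
  rw [h.coe_join_eq_insert_cone]
  exact isFace_insert h.notMem_cone

theorem isFace_cone_right_join (h : LinkAdj ρ v w) : IsFace (cone ρ w).1 (join ρ v w).1 :=
  h.join_comm ▸ h.symm.isFace_cone_join

theorem eq_cone_of_isFace (h : LinkAdj ρ v w) {τ : K.Cell} (hρτ : IsFace ρ.1 τ.1)
    (hτ : τ.1 ⊆ (join ρ v w).1) : τ = cone ρ v ∨ τ = cone ρ w := by
  obtain ⟨u, rfl⟩ := exists_cone_eq hρτ
  have hu : u.1 ∈ (join ρ v w).1 := hτ (Finset.mem_insert_self _ _)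
  rw [h.coe_join, Finset.mem_insert, Finset.mem_insert] at hu
  rcases hu with hu | hu | hu
  · exact .inl (congrArg _ (Subtype.ext hu))
  · exact .inr (congrArg _ (Subtype.ext hu))
  · exact absurd hu (not_mem_of_mem_link u.2)

end LinkAdj

theorem exists_linkAdj_join_eq {ρ : K.Cell} {v : K.link ρ} {σ : K.Cell}
    (h : IsFace (cone ρ v).1 σ.1) : ∃ w, LinkAdj ρ v w ∧ join ρ v w = σ := by
  obtain ⟨w, hw, hσ⟩ := (isFace_iff_covBy.1 h).exists_finset_insert
  have hw_link : w ∈ K.link ρ :=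
    mem_link_of_insert_mem_faces (fun hwρ => hw (Finset.mem_insert_of_mem hwρ))
      (K.down_closed (hσ ▸ σ.2.1) (Finset.insert_subset_insert _ (isFace_cone ρ v).1))
  have hadj : LinkAdj ρ v ⟨w, hw_link⟩ := by
    refine ⟨fun heq => hw (heq ▸ Finset.mem_insert_self _ _), ?_⟩
    rw [Finset.insert_comm]
    exact hσ ▸ σ.2.1
  exact ⟨_, hadj, Subtype.ext (hadj.coe_join_eq_insert_cone.trans hσ)⟩

/-- The neighbours of `v` in the link graph correspond to the cofaces of `v ∪ ρ`. -/
noncomputable def joinEquiv (ρ : K.Cell) (v : K.link ρ) :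
    {w | LinkAdj ρ v w} ≃ {σ : K.Cell // IsFace (cone ρ v).1 σ.1} :=
  Equiv.ofBijective (fun w => ⟨join ρ v w, w.2.isFace_cone_join⟩) <| by
    refine ⟨fun w w' h => ?_, fun σ => ?_⟩
    · have heq : (join ρ v w).1 = (join ρ v w').1 := congrArg (fun σ => σ.1.1) h
      rw [w.2.coe_join_eq_insert_cone, w'.2.coe_join_eq_insert_cone] at heq
      exact Subtype.ext (Subtype.ext ((Finset.insert_inj w.2.notMem_cone).1 heq))
    · obtain ⟨w, hw, hσ⟩ := exists_linkAdj_join_eq σ.2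
      exact ⟨⟨w, hw⟩, Subtype.ext hσ⟩

open Classical in
theorem tsum_coface_cone {M : Type*} [AddCommMonoid M] [TopologicalSpace M] (ρ : K.Cell)
    (v : K.link ρ) (F : K.Cell → M) :
    ∑' σ : {σ : K.Cell // IsFace (cone ρ v).1 σ.1}, F σ =
      ∑' w, if LinkAdj ρ v w then F (join ρ v w) else 0 := by
  rw [← (joinEquiv ρ v).tsum_eq]
  exact tsum_subtype {w | LinkAdj ρ v w} fun w => F (join ρ v w)

open Classical in
theorem linkGraph_b (hK : K.LocallySummable) (ρ : K.Cell) (v w : K.link ρ) :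
    (K.linkGraph hK ρ).b v w = if LinkAdj ρ v w then K.m (join ρ v w) else 0 := by
  change K.linkWeight ρ v w = _
  unfold linkWeight
  exact if_ctx_congr Iff.rfl (fun h => by rw [LinkAdj.coe_join h]) fun _ => rfl

/-! ## Second cofaces -/

/-- The simplices that contain `ρ` and have exactly two more vertices, i.e. the cofaces of the
cofaces of `ρ`. -/
def secondCofaces (ρ : K.Cell) : Set K.Cell := {σ | ρ.1 ⊆ σ.1 ∧ σ.1.card = ρ.1.card + 2}

theorem mem_secondCofaces_of_isFace {ρ τ σ : K.Cell} (hτ : IsFace ρ.1 τ.1) (hσ : IsFace τ.1 σ.1) :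
    σ ∈ secondCofaces ρ :=
  ⟨hτ.1.trans hσ.1, by rw [(isFace_iff_card.1 hσ).2, (isFace_iff_card.1 hτ).2]⟩

theorem LinkAdj.join_mem_secondCofaces {ρ : K.Cell} {v w : K.link ρ} (h : LinkAdj ρ v w) :
    join ρ v w ∈ secondCofaces ρ :=
  mem_secondCofaces_of_isFace (isFace_cone ρ v) h.isFace_cone_join

theorem encard_isFace_isFace {ρ σ : K.Cell} (h : σ ∈ secondCofaces ρ) :
    {τ : K.Cell | IsFace ρ.1 τ.1 ∧ IsFace τ.1 σ.1}.encard = 2 := by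
  have hcoe : Subtype.val '' {τ : K.Cell | IsFace ρ.1 τ.1 ∧ IsFace τ.1 σ.1} =
      (Finset.Ioo ρ.1 σ.1 : Set (Finset X)) := by
    ext τ
    rw [Finset.mem_coe, Finset.mem_Ioo]
    refine ⟨?_, fun ⟨hρτ, hτσ⟩ => ?_⟩
    · rintro ⟨τ, ⟨hρτ, hτσ⟩, rfl⟩
      exact ⟨(isFace_iff_covBy.1 hρτ).lt, (isFace_iff_covBy.1 hτσ).lt⟩
    have hρ := Finset.card_lt_card hρτ
    have hσ := Finset.card_lt_card hτσ
    have hcard := h.2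
    refine ⟨⟨τ, K.down_closed σ.2.1 hτσ.1, fun h0 => ?_⟩, ⟨?_, ?_⟩, rfl⟩
    · exact absurd (Finset.card_eq_zero.2 h0) (by lia)
    · exact isFace_iff_card.2 ⟨hρτ.1, by lia⟩
    · exact isFace_iff_card.2 ⟨hτσ.1, by lia⟩
  rw [← Subtype.val_injective.encard_image, hcoe, Set.encard_coe_eq_coe_finsetCard,
    Finset.card_Ioo_finset h.1, h.2, Nat.add_sub_cancel_left]
  rfl

theorem tsum_coface_coface (ρ : K.Cell) (F : K.Cell → ℝ≥0∞) :
    ∑' τ : {τ : K.Cell // IsFace ρ.1 τ.1}, ∑' σ : {σ : K.Cell // IsFace τ.1.1 σ.1}, F σ =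
      2 * ∑' σ : secondCofaces ρ, F σ := by
  have hcount (σ : K.Cell) :
      ∑' _ : {τ : K.Cell | IsFace ρ.1 τ.1 ∧ IsFace τ.1 σ.1}, F σ =
        2 * (secondCofaces ρ).indicator F σ := by
    rw [ENNReal.tsum_set_const]
    by_cases hσ : σ ∈ secondCofaces ρ
    · rw [encard_isFace_isFace hσ, Set.indicator_of_mem hσ]
      rfl
    · have hempty : {τ : K.Cell | IsFace ρ.1 τ.1 ∧ IsFace τ.1 σ.1} = ∅ :=
        Set.eq_empty_of_forall_notMem fun τ hτ => hσ (mem_secondCofaces_of_isFace hτ.1 hτ.2)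
      simp [hempty, hσ]
  let swap : (Σ τ : {τ : K.Cell // IsFace ρ.1 τ.1}, {σ : K.Cell // IsFace τ.1.1 σ.1}) ≃
      Σ σ : K.Cell, {τ : K.Cell | IsFace ρ.1 τ.1 ∧ IsFace τ.1 σ.1} :=
    ⟨fun q => ⟨q.2, q.1, q.1.2, q.2.2⟩, fun q => ⟨⟨q.2, q.2.2.1⟩, q.1, q.2.2.2⟩,
      fun _ => rfl, fun _ => rfl⟩
  rw [tsum_subtype (secondCofaces ρ), ← ENNReal.tsum_mul_left, ← tsum_congr hcount,
    ← ENNReal.tsum_sigma, ← ENNReal.tsum_sigma, ← swap.tsum_eq]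
  rfl

theorem exists_forall_isFace_of_ne {ρ ρ' : K.Cell} (hne : ρ' ≠ ρ) {σ : K.Cell}
    (hσ : σ ∈ secondCofaces ρ ∩ secondCofaces ρ') :
    ∃ τ : K.Cell, ∀ σ ∈ secondCofaces ρ ∩ secondCofaces ρ', IsFace τ.1 σ.1 := by
  have hsub : ¬ρ'.1 ⊆ ρ.1 := fun hsub =>
    hne (Subtype.ext (Finset.eq_of_subset_of_card_le hsub (by have := hσ.1.2; have := hσ.2.2; lia)))
  obtain ⟨u, hu', hu⟩ := Finset.not_subset.1 hsub
  have hmem {σ : K.Cell} (hσ : σ ∈ secondCofaces ρ ∩ secondCofaces ρ') : insert u ρ.1 ⊆ σ.1 :=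
    Finset.insert_subset (hσ.2.1 hu') hσ.1.1
  exact ⟨⟨insert u ρ.1, insert_mem_cells (K.down_closed σ.2.1 (hmem hσ))⟩, fun σ hσ =>
    isFace_iff_card.2 ⟨hmem hσ, by rw [hσ.1.2, Finset.card_insert_of_notMem hu]⟩⟩

namespace Coboundary

/-! ## The flow on the link graph -/

variable (δ : K.Coboundary)

theorem θ_eq_zero {τ σ : K.Cell} (h : ¬IsFace τ.1 σ.1) : δ.θ τ σ = 0 :=
  not_ne_iff.1 (mt (δ.ne_zero_iff τ σ).1 h)

theorem θ_eq_one_or_neg_one {τ σ : K.Cell} (h : IsFace τ.1 σ.1) :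
    δ.θ τ σ = 1 ∨ δ.θ τ σ = -1 := by
  rcases δ.sign τ σ with hθ | hθ | hθ
  · exact .inl hθ
  · exact .inr hθ
  · exact absurd hθ ((δ.ne_zero_iff τ σ).2 h)

theorem θ_mul_self {τ σ : K.Cell} (h : IsFace τ.1 σ.1) : δ.θ τ σ * δ.θ τ σ = 1 :=
  mul_self_eq_one_iff.2 (δ.θ_eq_one_or_neg_one h)

theorem norm_θ {τ σ : K.Cell} (h : IsFace τ.1 σ.1) : ‖δ.θ τ σ‖ = 1 := by
  rcases δ.θ_eq_one_or_neg_one h with hθ | hθ <;> simp [hθ]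

theorem op_join {ρ : K.Cell} {η : K.Cell → ℂ} (hη : ∀ τ : K.Cell, ¬IsFace ρ.1 τ.1 → η τ = 0)
    {v w : K.link ρ} (h : LinkAdj ρ v w) :
    δ.op η (join ρ v w) = δ.θ (cone ρ v) (join ρ v w) * η (cone ρ v) +
      δ.θ (cone ρ w) (join ρ v w) * η (cone ρ w) := by
  classical
  rw [δ.apply_eq, finsum_mem_eq_sum_of_inter_support_eq (t := {cone ρ v, cone ρ w}),
    Finset.sum_pair fun heq => h.1 (cone_injective ρ heq)]
  · rfl
  ext τ
  rw [Finset.coe_pair]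
  refine and_congr_left fun hne => ⟨fun hτ => ?_, ?_⟩
  · exact h.eq_cone_of_isFace (not_imp_comm.1 (hη τ) (right_ne_zero_of_mul hne)) hτ.1
  · rintro (rfl | rfl)
    exacts [h.isFace_cone_join, h.isFace_cone_right_join]

/-- This is `δδ = 0`, evaluated at `1_ρ` and `{v, w} ∪ ρ`. -/
theorem θ_antisymm {ρ : K.Cell} {v w : K.link ρ} (h : LinkAdj ρ v w) :
    δ.θ ρ (cone ρ w) * δ.θ (cone ρ w) (join ρ v w) =
      -(δ.θ ρ (cone ρ v) * δ.θ (cone ρ v) (join ρ v w)) := by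
  have hop := δ.op_join (η := δ.θ ρ) (fun τ hτ => δ.θ_eq_zero hτ) h
  have hzero : δ.op (δ.θ ρ) (join ρ v w) = 0 := congrFun (δ.op_op _) _
  linear_combination hzero - hop

open Classical in
/-- The flow on the link graph of `ρ` induced by a function `ω` on the simplices. It is normalised
so that its divergence at `v` is `±m(vρ) ∂ω(vρ)`. -/
noncomputable def linkFlow (ω : K.Cell → ℂ) (ρ : K.Cell) (v w : K.link ρ) : ℂ :=
  if LinkAdj ρ v w then δ.θ ρ (cone ρ v) * δ.θ (cone ρ v) (join ρ v w) * ω (join ρ v w) else 0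

theorem linkFlow_antisymm (ω : K.Cell → ℂ) (ρ : K.Cell) (v w : K.link ρ) :
    δ.linkFlow ω ρ w v = -δ.linkFlow ω ρ v w := by
  unfold linkFlow
  by_cases h : LinkAdj ρ v w
  · rw [if_pos h, if_pos h.symm, ← h.join_comm, δ.θ_antisymm h, neg_mul]
  · rw [if_neg h, if_neg fun h' => h h'.symm, neg_zero]

theorem norm_linkFlow (ω : K.Cell → ℂ) {ρ : K.Cell} {v w : K.link ρ} (h : LinkAdj ρ v w) :
    ‖δ.linkFlow ω ρ v w‖ = ‖ω (join ρ v w)‖ := by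
  rw [linkFlow, if_pos h, norm_mul, norm_mul, δ.norm_θ (isFace_cone ρ v),
    δ.norm_θ h.isFace_cone_join, one_mul, one_mul]

variable (hK : K.LocallySummable)

theorem divergence_linkFlow (ω : K.Cell → ℂ) (ρ : K.Cell) (v : K.link ρ) :
    (K.linkGraph hK ρ).divergence (δ.linkFlow ω ρ) v =
      K.m (cone ρ v) * δ.θ ρ (cone ρ v) * δ.boundary ω (cone ρ v) := by
  classical
  have hm : (K.m (cone ρ v) : ℂ) ≠ 0 := Complex.ofReal_ne_zero.2 (m_cell_pos _).ne'
  rw [boundary, tsum_coface_cone ρ v fun σ => (K.m σ : ℂ) * δ.θ (cone ρ v) σ * ω σ,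
    mul_right_comm, ← mul_assoc, mul_one_div_cancel hm, one_mul, mul_comm, ← tsum_mul_left]
  refine tsum_congr fun w => ?_
  rw [linkGraph_b, linkFlow, Complex.real_smul]
  split_ifs
  · ring
  · simp

theorem boundary_boundary_eq (ω : K.Cell → ℂ) (ρ : K.Cell) :
    δ.boundary (δ.boundary ω) ρ =
      1 / K.m ρ * ∑' v, (K.linkGraph hK ρ).divergence (δ.linkFlow ω ρ) v := by
  rw [boundary, ← (coneEquiv ρ).tsum_eq]
  simp only [coe_coneEquiv, ← δ.divergence_linkFlow hK]

theorem summable_norm_divergence_linkFlow_iff (ω : K.Cell → ℂ) (ρ : K.Cell) :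
    (Summable fun v => ‖(K.linkGraph hK ρ).divergence (δ.linkFlow ω ρ) v‖) ↔
      Summable fun τ : {τ : K.Cell // IsFace ρ.1 τ.1} => K.m τ.1 * ‖δ.boundary ω τ.1‖ := by
  rw [← (coneEquiv ρ).summable_iff]
  refine summable_congr fun v => ?_
  rw [δ.divergence_linkFlow, norm_mul, norm_mul, δ.norm_θ (isFace_cone ρ v), mul_one,
    Complex.norm_real, Real.norm_of_nonneg (m_cell_pos _).le, Function.comp_apply, coe_coneEquiv]

theorem energy_linkFlow (ω : K.Cell → ℂ) (ρ : K.Cell) :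
    (K.linkGraph hK ρ).energy (δ.linkFlow ω ρ) =
      2 * ∑' σ : secondCofaces ρ, ENNReal.ofReal (K.m σ) * ‖ω σ‖ₑ ^ 2 := by
  classical
  rw [← tsum_coface_coface ρ fun σ => ENNReal.ofReal (K.m σ) * ‖ω σ‖ₑ ^ 2,
    ← (coneEquiv ρ).tsum_eq, WeightedGraph.energy, ENNReal.tsum_prod']
  refine tsum_congr fun v => ?_
  rw [coe_coneEquiv, tsum_coface_cone ρ v fun σ => ENNReal.ofReal (K.m σ) * ‖ω σ‖ₑ ^ 2]
  refine tsum_congr fun w => ?_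
  rw [linkGraph_b]
  split_ifs with h
  · rw [← ofReal_norm, δ.norm_linkFlow ω h, ofReal_norm]
  · simp

end Coboundary

/-! ## Square summable functions and the boundary domains -/

theorem summable_coface_iff {ω : K.Cell → ℂ} {ρ : K.Cell} :
    (Summable fun τ : {τ : K.Cell // IsFace ρ.1 τ.1} => K.m τ.1 * ‖ω τ.1‖) ↔
      ∑' τ : {τ : K.Cell // IsFace ρ.1 τ.1}, ENNReal.ofReal (K.m τ.1) * ‖ω τ.1‖ₑ ≠ ⊤ := by
  simpa only [pow_one] using summable_mul_norm_pow_iff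
    (fun τ : {τ : K.Cell // IsFace ρ.1 τ.1} => (m_cell_pos τ.1).le) (fun τ => ω τ.1) 1

theorem ell2_subset_boundaryDomain (hK : K.LocallySummable) : K.ell2 ⊆ K.boundaryDomain := by
  intro ω hω ρ
  refine Summable.of_nonneg_of_le (fun τ => mul_nonneg (m_cell_pos _).le (norm_nonneg _))
    (fun τ => ?_) ((hK ρ).add (hω.comp_injective Subtype.val_injective))
  rw [Function.comp_apply, ← mul_one_add]
  exact mul_le_mul_of_nonneg_left (by nlinarith [sq_nonneg (‖ω τ.1‖ - 1)]) (m_cell_pos _).le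

namespace Coboundary

variable (δ : K.Coboundary)

theorem energy_linkFlow_ne_top (hK : K.LocallySummable) {ω : K.Cell → ℂ} (hω : ω ∈ K.ell2)
    (ρ : K.Cell) : (K.linkGraph hK ρ).energy (δ.linkFlow ω ρ) ≠ ⊤ := by
  rw [energy_linkFlow]
  exact ENNReal.mul_ne_top ENNReal.ofNat_ne_top (ne_top_of_le_ne_top (mem_ell2_iff.1 hω)
    (ENNReal.tsum_comp_le_tsum_of_injective Subtype.val_injective _))

theorem mem_ell2_of_energy_linkFlow_ne_top (hK : K.LocallySummable) {ω : K.Cell → ℂ} {ρ : K.Cell}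
    (hsupp : Function.support ω ⊆ secondCofaces ρ)
    (h : (K.linkGraph hK ρ).energy (δ.linkFlow ω ρ) ≠ ⊤) : ω ∈ K.ell2 := by
  rw [mem_ell2_iff, ← tsum_subtype_eq_of_support_subset (s := secondCofaces ρ)
    (Function.support_subset_iff'.2 fun σ hσ => by
      simp [Function.notMem_support.1 fun h => hσ (hsupp h)])]
  rw [energy_linkFlow] at h
  exact fun htop => h (by rw [htop]; simp)

theorem m_mul_enorm_boundary_le (ω : K.Cell → ℂ) (τ : K.Cell) :
    ENNReal.ofReal (K.m τ) * ‖δ.boundary ω τ‖ₑ ≤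
      ∑' σ : {σ : K.Cell // IsFace τ.1 σ.1}, ENNReal.ofReal (K.m σ.1) * ‖ω σ.1‖ₑ := by
  have hm : (K.m τ : ℂ) ≠ 0 := Complex.ofReal_ne_zero.2 (m_cell_pos τ).ne'
  have enorm_m (σ : K.Cell) : ‖(K.m σ : ℂ)‖ₑ = ENNReal.ofReal (K.m σ) := by
    rw [← ofReal_norm, Complex.norm_of_nonneg (m_cell_pos σ).le]
  rw [← enorm_m, ← enorm_mul, boundary, ← mul_assoc, mul_one_div_cancel hm, one_mul]
  refine enorm_tsum_le_tsum_enorm.trans_eq (tsum_congr fun σ => ?_)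
  rw [enorm_mul, enorm_mul, enorm_m, ← ofReal_norm (δ.θ τ σ.1), δ.norm_θ σ.2,
    ENNReal.ofReal_one, mul_one]

theorem boundary_mem_boundaryDomain {ω : K.Cell → ℂ} (hω : ω ∈ K.boundaryDomain) {ρ : K.Cell}
    (hsupp : Function.support ω ⊆ secondCofaces ρ)
    (hρ : Summable fun τ : {τ : K.Cell // IsFace ρ.1 τ.1} => K.m τ.1 * ‖δ.boundary ω τ.1‖) :
    δ.boundary ω ∈ K.boundaryDomain := by
  intro ρ'
  rcases eq_or_ne ρ' ρ with rfl | hne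
  · exact hρ
  set F : K.Cell → ℝ≥0∞ := fun σ => ENNReal.ofReal (K.m σ) * ‖ω σ‖ₑ with hF
  have hFsupp (σ : K.Cell) (hσ : F σ ≠ 0) : σ ∈ secondCofaces ρ :=
    hsupp fun h => hσ (by simp [hF, h])
  have hle : ∑' τ : {τ : K.Cell // IsFace ρ'.1 τ.1},
      ENNReal.ofReal (K.m τ.1) * ‖δ.boundary ω τ.1‖ₑ ≤ 2 * ∑' σ : secondCofaces ρ', F σ :=
    (ENNReal.tsum_le_tsum fun τ : {τ : K.Cell // IsFace ρ'.1 τ.1} =>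
      δ.m_mul_enorm_boundary_le ω τ.1).trans_eq
      (tsum_coface_coface ρ' F)
  refine summable_coface_iff.2
    (ne_top_of_le_ne_top (ENNReal.mul_ne_top ENNReal.ofNat_ne_top ?_) hle)
  rcases (secondCofaces ρ ∩ secondCofaces ρ').eq_empty_or_nonempty with hempty | ⟨σ, hσ⟩
  · have hzero (σ : secondCofaces ρ') : F σ = 0 := by
      by_contra h
      exact hempty.subset ⟨hFsupp σ h, σ.2⟩
    simp [hzero]
  obtain ⟨τ, hτ⟩ := exists_forall_isFace_of_ne hne hσ
  refine ne_top_of_le_ne_top (summable_coface_iff.1 (hω τ)) ?_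
  change _ ≤ ∑' σ : {σ : K.Cell | IsFace τ.1 σ.1}, F σ
  rw [tsum_subtype, tsum_subtype]
  refine ENNReal.tsum_le_tsum fun σ => Set.indicator_le (fun σ hσ => ?_) σ
  by_cases h : F σ = 0
  · simp [h]
  · exact (Set.indicator_of_mem (s := {σ | IsFace τ.1 σ.1}) (hτ σ ⟨hFsupp σ h, hσ⟩) F).ge

/-- With `η(vρ) = θ(ρ, vρ) f(v)`, take `ω = δη`, restricted to the second cofaces of `ρ`. -/
theorem exists_linkFlow_eq_grad (ρ : K.Cell) (f : K.link ρ → ℂ) :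
    ∃ ω : K.Cell → ℂ, Function.support ω ⊆ secondCofaces ρ ∧
      ∀ v w, LinkAdj ρ v w → δ.linkFlow ω ρ v w = WeightedGraph.grad f v w := by
  classical
  let η : K.Cell → ℂ := fun τ =>
    if h : IsFace ρ.1 τ.1 then δ.θ ρ τ * f ((coneEquiv ρ).symm ⟨τ, h⟩) else 0
  have hη (v : K.link ρ) : η (cone ρ v) = δ.θ ρ (cone ρ v) * f v := by
    have hv : (coneEquiv ρ).symm ⟨cone ρ v, isFace_cone ρ v⟩ = v :=
      (coneEquiv ρ).symm_apply_apply v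
    simp only [η, dif_pos (isFace_cone ρ v), hv]
  refine ⟨(secondCofaces ρ).indicator (δ.op η), Set.support_indicator_subset, fun v w h => ?_⟩
  rw [linkFlow, if_pos h, Set.indicator_of_mem h.join_mem_secondCofaces,
    δ.op_join (η := η) (fun τ hτ => dif_neg hτ) h, hη, hη, WeightedGraph.grad]
  have hantisymm := δ.θ_antisymm h
  have hsq := δ.θ_mul_self (isFace_cone ρ v)
  have hsq' := δ.θ_mul_self h.isFace_cone_join
  set a := δ.θ ρ (cone ρ v)
  set b := δ.θ (cone ρ v) (join ρ v w)
  linear_combination (b * b * hsq + hsq') * (f v - f w) + a * b * f w * hantisymm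

theorem exists_mem_ell2_boundary_boundary_ne_zero (hK : K.LocallySummable) {ρ : K.Cell}
    {f : K.link ρ → ℝ} {o : K.link ρ} {c : ℝ} (hc : c ≠ 0)
    (hf : (K.linkGraph hK ρ).energy (WeightedGraph.grad f) ≠ ⊤)
    (hdiv : (K.linkGraph hK ρ).divergence (WeightedGraph.grad f) =
      ({o} : Set (K.link ρ)).indicator fun _ => c) :
    ∃ ω ∈ K.boundaryBoundaryDomain δ ∩ K.ell2, δ.boundary (δ.boundary ω) ρ ≠ 0 := by
  classical
  obtain ⟨ω, hsupp, hω⟩ := δ.exists_linkFlow_eq_grad ρ fun v => (f v : ℂ)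
  have hflow (v w : K.link ρ) (h : (K.linkGraph hK ρ).b v w ≠ 0) :
      δ.linkFlow ω ρ v w = WeightedGraph.grad (fun v => (f v : ℂ)) v w :=
    hω v w (by_contra fun hadj => h (by rw [linkGraph_b, if_neg hadj]))
  have henergy : (K.linkGraph hK ρ).energy (δ.linkFlow ω ρ) ≠ ⊤ := by
    rwa [WeightedGraph.energy_congr fun v w h => congrArg norm (hflow v w h),
      WeightedGraph.energy_grad_ofReal]
  have hdivω : (K.linkGraph hK ρ).divergence (δ.linkFlow ω ρ) = Pi.single o (c : ℂ) := by
    ext v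
    rw [WeightedGraph.divergence_congr (hflow v), WeightedGraph.divergence_grad_ofReal, hdiv]
    rcases eq_or_ne v o with rfl | hv
    · simp
    · simp [hv]
  have hell2 := δ.mem_ell2_of_energy_linkFlow_ne_top hK hsupp henergy
  have hdomain := ell2_subset_boundaryDomain hK hell2
  have hsummable : Summable fun v => ‖(K.linkGraph hK ρ).divergence (δ.linkFlow ω ρ) v‖ :=
    summable_of_ne_finset_zero (s := {o}) fun v hv => by simp_all
  refine ⟨ω, ⟨⟨hdomain, δ.boundary_mem_boundaryDomain hdomain hsupp
    ((δ.summable_norm_divergence_linkFlow_iff hK ω ρ).1 hsummable)⟩, hell2⟩, ?_⟩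
  rw [δ.boundary_boundary_eq hK, hdivω, tsum_pi_single]
  simp [hc, (m_cell_pos ρ).ne']

theorem boundary_boundary_eq_zero_of_forall_isRecurrent (hK : K.LocallySummable) {ρ : K.Cell}
    (hρ : ∀ C : (K.linkGraph hK ρ).toSimpleGraph.ConnectedComponent,
      ((K.linkGraph hK ρ).induce C.supp).IsRecurrent)
    {ω : K.Cell → ℂ} (hω : ω ∈ K.boundaryBoundaryDomain δ ∩ K.ell2) :
    δ.boundary (δ.boundary ω) ρ = 0 := by
  rw [δ.boundary_boundary_eq hK, WeightedGraph.tsum_divergence_eq_zero_of_forall_isRecurrent hρ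
    (δ.linkFlow_antisymm ω ρ) (δ.energy_linkFlow_ne_top hK hω.2 ρ)
    ((δ.summable_norm_divergence_linkFlow_iff hK ω ρ).2 (hω.1.2 ρ)), mul_zero]

end Coboundary

end WeightedComplex

theorem mainTheorem1 {X : Type*} [DecidableEq X] (K : WeightedComplex X)
    (hK : K.LocallySummable) (δ : K.Coboundary) (ρ : K.Cell) :
    (∀ ω ∈ K.boundaryBoundaryDomain δ ∩ K.ell2, δ.boundary (δ.boundary ω) ρ = 0) ↔
      ∀ C : (K.linkGraph hK ρ).toSimpleGraph.ConnectedComponent,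
        ((K.linkGraph hK ρ).induce C.supp).IsRecurrent := by
  refine ⟨fun h => ?_, fun hρ ω hω => δ.boundary_boundary_eq_zero_of_forall_isRecurrent hK hρ hω⟩
  by_contra hρ
  obtain ⟨f, o, c, hc, hf, hdiv⟩ := WeightedGraph.exists_potential_of_not_forall_isRecurrent hρ
  obtain ⟨ω, hω, hne⟩ := δ.exists_mem_ell2_boundary_boundary_ne_zero hK hc hf hdiv
  exact hne (h ω hω)
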